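/- Let $(\Omega,\mathcal F,\mathbb P)$ be a probability space and let $M$ run through a strictly increasing sequence of natural numbers. For each $M$ let $\Theta\in\mathbb C^{M\times M}$ be a deterministic Hermitian positive semidefinite matrix, with positive semidefinite square root $\Theta^{1/2}$, and let $L,R,\bar A\in\mathbb C^{M\times M}$ be (possibly random) matrices. Assume that * $\sup_M\|\Theta\|<\infty$ and, almost surely, the spectral norms of $L$, $R$, $\bar A$ are bounded in $M$; * $\bar A$ is almost surely invertible and, almost surely, $\|\bar A^{-1}\|$ is bounded in $M$ and $\liminf_{M\to\infty}|1+u|>0$, where $u=\frac1M\operatorname{tr}(\Theta\bar A^{-1})$. (Both conditions hold for instance if $\bar A$ is Hermitian with $\bar A\succeq\alpha I_M$ for a fixed $\alpha>0$.) For each $M$ let $z',q,w\in\mathbb C^M$ be random vectors such that $z'$, $q$, $w$ and the triple $(L,R,\bar A)$ are mutually independent. Each of $z',q,w$ has i.i.d. complex entries with zero mean, variance $1/M$ and eighth absolute moment at most $C/M^4$ with a constant $C$ that does not depend on $M$. Let $\rho\in[-1,1]$, $z=\rho z'+\sqrt{1-\rho^2}\,w$, and put $x=\Theta^{1/2}z$,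 $x'=\Theta^{1/2}z'$, $y=\Theta^{1/2}q$. Let $c_0,c_1,c_2\ge 0$ be real numbers with $c_0+c_1=1$ and $c_0c_1=c_2^2$, and define $$A=\bar A+c_0xx^{H}+c_1yy^{H}+c_2xy^{H}+c_2yx^{H},\qquad A'=\bar A+c_0x'x'^{H}+c_1yy^{H}+c_2x'y^{H}+c_2yx'^{H},$$ $$u_L=\tfrac1M\operatorname{tr}(\Theta L\bar A^{-1}),\qquad u_R=\tfrac1M\operatorname{tr}(\Theta\bar A^{-1}R),\qquad u_{LR}=\tfrac1M\operatorname{tr}(\Theta L\bar A^{-1}R).$$ Then, almost surely, $A$ and $A'$ are invertible for all sufficiently large $M$, and, writing $a\asymp b$ if $a-b\to0$ almost surely as $M\to\infty$, $$x^{H}LA^{-1}Rx\asymp u_{LR}-\frac{c_0u_Lu_R}{1+u},\qquad x^{H}LA^{-1}Ry\asymp-\frac{c_2u_Lu_R}{1+u},\qquad x^{H}LA'^{-1}Ry\asymp-\rho\,\frac{c_2u_Lu_R}{1+u}.$$ -/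

import Mathlib

open MeasureTheory ProbabilityTheory Filter Topology
open scoped Matrix Matrix.Norms.L2Operator MatrixOrder ComplexOrder

namespace RandomMatrix

/-- Matrices carry the product sigma-algebra of their entries. -/
noncomputable instance instMeasurableSpaceMatrix {m n : Type*} : MeasurableSpace (Matrix m n ℂ) :=
  (inferInstance : MeasurableSpace (m → n → ℂ))

/-- A sequence of random vectors `z N ∈ ℂ ^ (M N)` such that, for every `N`, the entries of `z N` are
independent and identically distributed with mean `0` and variance `1 / M N`, and such that their
eighth absolute moments are of order `O(1 / (M N) ^ 4)`. -/
structure IsIIDSequence {Ω : Type*} [MeasurableSpace Ω] (μ : Measure Ω) (M : ℕ → ℕ)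
    (z : ∀ N : ℕ, Ω → Fin (M N) → ℂ) : Prop where
  measurable : ∀ N, Measurable (z N)
  indep : ∀ N, iIndepFun (fun (i : Fin (M N)) (ω : Ω) => z N ω i) μ
  identDistrib : ∀ N (i j : Fin (M N)),
    IdentDistrib (fun ω => z N ω i) (fun ω => z N ω j) μ μ
  mean : ∀ N (i : Fin (M N)), ∫ ω, z N ω i ∂μ = 0
  variance : ∀ N (i : Fin (M N)), ∫ ω, ‖z N ω i‖ ^ 2 ∂μ = 1 / (M N : ℝ)
  eighthMoment : ∃ C : ℝ, ∀ N (i : Fin (M N)),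
    ∫⁻ ω, ENNReal.ofReal (‖z N ω i‖ ^ 8) ∂μ ≤ ENNReal.ofReal (C / (M N : ℝ) ^ 4)

/-- `f ≍ g`: almost surely, `f N - g N → 0` as `N → ∞`. -/
def AsympEq {Ω : Type*} [MeasurableSpace Ω] (μ : Measure Ω) (f g : ℕ → Ω → ℂ) : Prop :=
  ∀ᵐ ω ∂μ, Tendsto (fun N => f N ω - g N ω) atTop (𝓝 0)

/-- `Θ^{1/2} z`, with the positive semidefinite square root of `Θ`. -/
noncomputable def correlated {m : ℕ} (Θ : Matrix (Fin m) (Fin m) ℂ) (z : Fin m → ℂ) : Fin m → ℂ :=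
  CFC.sqrt Θ *ᵥ z

/-- `Ā + c₀ x xᴴ + c₁ y yᴴ + c₂ x yᴴ + c₂ y xᴴ`. -/
noncomputable def perturb {m : ℕ} (Abar : Matrix (Fin m) (Fin m) ℂ) (c₀ c₁ c₂ : ℝ)
    (x y : Fin m → ℂ) : Matrix (Fin m) (Fin m) ℂ :=
  Abar + (c₀ : ℂ) • Matrix.vecMulVec x (star x) + (c₁ : ℂ) • Matrix.vecMulVec y (star y)
    + (c₂ : ℂ) • Matrix.vecMulVec x (star y) + (c₂ : ℂ) • Matrix.vecMulVec y (star x)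

/-- `xᴴ B y`. -/
def sesq {m : ℕ} (x : Fin m → ℂ) (B : Matrix (Fin m) (Fin m) ℂ) (y : Fin m → ℂ) : ℂ :=
  star x ⬝ᵥ (B *ᵥ y)

/-- The normalized trace `tr(B) / m`. -/
noncomputable def ntr {m : ℕ} (B : Matrix (Fin m) (Fin m) ℂ) : ℂ := B.trace / (m : ℂ)

/-- Almost surely, the spectral norms of the random matrices `B N` are bounded in `N`. -/
def AEBounded {Ω : Type*} [MeasurableSpace Ω] (μ : Measure Ω) {M : ℕ → ℕ}
    (B : ∀ N : ℕ, Ω → Matrix (Fin (M N)) (Fin (M N)) ℂ) : Prop :=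
  ∀ᵐ ω ∂μ, ∃ C : ℝ, ∀ N, ‖B N ω‖ ≤ C

end RandomMatrix

/-! Since `c₂ = √c₀ √c₁`, both perturbations have rank one: `A = Ā + s sᴴ` with `s = √c₀ x + √c₁ y`,
and `A'` likewise with `x'` in place of `x`. The Sherman–Morrison formula turns `xᴴ L A⁻¹ R y` into
`xᴴ L Ā⁻¹ R y - (xᴴ L Ā⁻¹ s)(sᴴ Ā⁻¹ R y) / (1 + sᴴ Ā⁻¹ s)`, in which every form has a middle matrix
independent of the vectors.

Each vector involved is `Θ^{1/2}` applied to a real combination of `z'`, `q`, `w` with unit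
coefficient vector. The trace lemma `asympEq_sesq` replaces a form with coefficient vectors `α`,
`α'` and matrix `B` by `⟨α, α'⟩ tr(Θ B) / M`. The result is then a computation of inner products in
`ℝ³`, with limits taken by `tendsto_sub_mul_div`.

The trace lemma rests on `lintegral_quadraticForm_le`: a centred quadratic form has fourth moment
`O(1 / M²)`, which is summable along strictly increasing `M`. That bound comes from adding the
variables one at a time. Each increment is centred given the earlier ones, so the fourth moment
grows by a factor `1 + t` plus a small term, and a discrete Grönwall argument sums up the growth. -/

namespace RandomMatrix

/-! ### Fourth moments when one independent centred variable is added. -/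

section Moments

variable {Ω : Type*} [MeasurableSpace Ω] {μ : Measure Ω}

/-- Fubini on the product law. It serves as conditioning on `X`: the inner integral is estimated
with `X` frozen. -/
theorem lintegral_comp_indepFun [IsProbabilityMeasure μ] {E F : Type*} [MeasurableSpace E]
    [MeasurableSpace F] {X : Ω → E} {Y : Ω → F} (hX : Measurable X) (hY : Measurable Y)
    (h : IndepFun X Y μ) {f : E → F → ENNReal} (hf : Measurable (Function.uncurry f)) :
    ∫⁻ ω, f (X ω) (Y ω) ∂μ = ∫⁻ ω, ∫⁻ ω', f (X ω) (Y ω') ∂μ ∂μ := by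
  have h1 := h.map_prod_eq_prod_map_map hX.aemeasurable hY.aemeasurable
  have h2 : ∫⁻ ω, f (X ω) (Y ω) ∂μ
      = ∫⁻ p, Function.uncurry f p ∂(μ.map (fun ω => (X ω, Y ω))) := by
    rw [lintegral_map hf (hX.prodMk hY)]
    rfl
  have := Measure.isProbabilityMeasure_map (μ := μ) hY.aemeasurable
  rw [h2, h1, lintegral_prod _ hf.aemeasurable,
    lintegral_map (Measurable.lintegral_prod_right' hf) hX]
  refine lintegral_congr fun ω => ?_
  exact lintegral_map (hf.comp measurable_prodMk_left) hY

/-- The term linear in `D` is kept exact because it integrates to zero for centred `D`. The other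
cross terms are absorbed by Young's inequality, where `t` is the price paid on `‖S‖ ^ 4`: they are
at most `8 ‖S‖² ‖D‖² + 3 ‖D‖⁴`, whence `19 = 16 + 3`. -/
theorem norm_add_pow_four_le (S D : ℂ) {t : ℝ} (ht : 0 < t) (ht1 : t ≤ 1) :
    ‖S + D‖ ^ 4 ≤ (1 + t) * ‖S‖ ^ 4 + 4 * ‖S‖ ^ 2 * (star S * D).re + 19 / t * ‖D‖ ^ 4 := by
  have h1 : ‖S + D‖ ^ 2 = ‖S‖ ^ 2 + 2 * (star S * D).re + ‖D‖ ^ 2 := by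
    rw [← Complex.normSq_eq_norm_sq, ← Complex.normSq_eq_norm_sq, ← Complex.normSq_eq_norm_sq]
    simp [Complex.normSq_apply]
    ring
  have h2 : |(star S * D).re| ≤ ‖S‖ * ‖D‖ := by
    refine (Complex.abs_re_le_norm _).trans ?_
    simp
  set r := (star S * D).re
  set s := ‖S‖
  set d := ‖D‖
  have hs : 0 ≤ s := norm_nonneg _
  have hd : 0 ≤ d := norm_nonneg _
  have h3 : r ^ 2 ≤ s ^ 2 * d ^ 2 := by
    rw [← mul_pow, ← sq_abs r]
    exact pow_le_pow_left₀ (abs_nonneg _) h2 2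
  have h4 : r * d ^ 2 ≤ s * d * d ^ 2 :=
    mul_le_mul_of_nonneg_right ((le_abs_self r).trans h2) (by positivity)
  have h5 : 4 * (s * d * d ^ 2) ≤ 2 * (s ^ 2 * d ^ 2) + 2 * d ^ 4 := by
    nlinarith [mul_nonneg (sq_nonneg (s - d)) (sq_nonneg d)]
  have h6 : 8 * (s ^ 2 * d ^ 2) ≤ t * s ^ 4 + 16 / t * d ^ 4 := by
    have : 0 ≤ (t * s ^ 2 - 4 * d ^ 2) ^ 2 / t := by positivity
    have e : (t * s ^ 2 - 4 * d ^ 2) ^ 2 / t = t * s ^ 4 + 16 / t * d ^ 4 - 8 * (s ^ 2 * d ^ 2) := by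
      field_simp
      ring
    linarith
  have h7 : 3 * d ^ 4 ≤ 3 / t * d ^ 4 := by
    refine mul_le_mul_of_nonneg_right ?_ (by positivity)
    rw [le_div_iff₀ ht]
    linarith
  have h8 : ‖S + D‖ ^ 4 = (s ^ 2 + 2 * r + d ^ 2) ^ 2 := by
    rw [← h1]
    ring
  have h9 : 19 / t * d ^ 4 = 16 / t * d ^ 4 + 3 / t * d ^ 4 := by ring
  rw [h8, h9]
  nlinarith

theorem lintegral_norm_const_add_pow_four_le [IsProbabilityMeasure μ] (S : ℂ) {D : Ω → ℂ}
    (hDm : Measurable D) (hD0 : ∫ ω, D ω ∂μ = 0) (hD4 : Integrable (fun ω => ‖D ω‖ ^ 4) μ)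
    {W : ℝ} (hW : ∫ ω, ‖D ω‖ ^ 4 ∂μ ≤ W) {t : ℝ} (ht : 0 < t) (ht1 : t ≤ 1) :
    ∫⁻ ω, ENNReal.ofReal (‖S + D ω‖ ^ 4) ∂μ
      ≤ ENNReal.ofReal ((1 + t) * ‖S‖ ^ 4 + 19 / t * W) := by
  have hD : Integrable D μ := by
    have : MemLp D (4 : ℕ) μ := by
      rw [← integrable_norm_rpow_iff hDm.aestronglyMeasurable (by simp) (by simp)]
      simpa using hD4
    exact this.integrable (by norm_num)
  have hDS : Integrable (fun ω => 4 * ‖S‖ ^ 2 * (star S * D ω).re) μ :=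
    ((hD.const_mul (star S)).re).const_mul _
  have hint : Integrable (fun ω => (1 + t) * ‖S‖ ^ 4 + 4 * ‖S‖ ^ 2 * (star S * D ω).re
      + 19 / t * ‖D ω‖ ^ 4) μ :=
    ((integrable_const _).add hDS).add (hD4.const_mul _)
  have hnn : ∀ ω, 0 ≤ (1 + t) * ‖S‖ ^ 4 + 4 * ‖S‖ ^ 2 * (star S * D ω).re
      + 19 / t * ‖D ω‖ ^ 4 := fun ω =>
    (by positivity : 0 ≤ ‖S + D ω‖ ^ 4).trans (norm_add_pow_four_le S (D ω) ht ht1)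
  have hre : ∫ ω, (star S * D ω).re ∂μ = 0 := by
    have h := integral_re (𝕜 := ℂ) (hD.const_mul (star S))
    simp only [RCLike.re_to_complex] at h
    rw [h, integral_const_mul, hD0]
    simp
  calc ∫⁻ ω, ENNReal.ofReal (‖S + D ω‖ ^ 4) ∂μ
      ≤ ∫⁻ ω, ENNReal.ofReal ((1 + t) * ‖S‖ ^ 4 + 4 * ‖S‖ ^ 2 * (star S * D ω).re
        + 19 / t * ‖D ω‖ ^ 4) ∂μ :=
        lintegral_mono fun ω => ENNReal.ofReal_le_ofReal (norm_add_pow_four_le S (D ω) ht ht1)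
    _ = ENNReal.ofReal (∫ ω, ((1 + t) * ‖S‖ ^ 4 + 4 * ‖S‖ ^ 2 * (star S * D ω).re
        + 19 / t * ‖D ω‖ ^ 4) ∂μ) :=
        (ofReal_integral_eq_lintegral_ofReal hint (ae_of_all _ hnn)).symm
    _ ≤ _ := by
        refine ENNReal.ofReal_le_ofReal ?_
        have hi : Integrable (fun ω => (1 + t) * ‖S‖ ^ 4
            + 4 * ‖S‖ ^ 2 * (star S * D ω).re) μ := (integrable_const _).add hDS
        rw [integral_add hi (hD4.const_mul _),
          integral_add (integrable_const _) hDS, integral_const_mul, integral_const_mul,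
          integral_const_mul, hre]
        simp only [integral_const, probReal_univ, one_smul, mul_zero, add_zero]
        gcongr

/-- A centred random variable whose fourth moment and whose centred square's fourth moment are
controlled, relative to the variance `v`, by `κ`. -/
structure HasMoments (μ : Measure Ω) (κ v : ℝ) (z : Ω → ℂ) : Prop where
  measurable : Measurable z
  mean : ∫ ω, z ω ∂μ = 0
  variance : ∫ ω, ‖z ω‖ ^ 2 ∂μ = v
  integrable : Integrable (fun ω => ‖z ω‖ ^ 8) μ
  fourth : ∫ ω, ‖z ω‖ ^ 4 ∂μ ≤ κ * v ^ 2
  centred : ∫ ω, (‖z ω‖ ^ 2 - v) ^ 4 ∂μ ≤ κ * v ^ 4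

/-- The part of a quadratic form in independent variables that involves one new variable `z`. -/
noncomputable def increment (v : ℝ) (a b d z : ℂ) : ℂ :=
  star z * a + b * z + ((‖z‖ ^ 2 - v : ℝ) : ℂ) * d

theorem measurable_increment (v : ℝ) :
    Measurable fun p : (ℂ × ℂ × ℂ) × ℂ => increment v p.1.1 p.1.2.1 p.1.2.2 p.2 := by
  refine Continuous.measurable ?_
  unfold increment
  fun_prop

theorem norm_increment_pow_four_le (v : ℝ) (a b d z : ℂ) :
    ‖increment v a b d z‖ ^ 4 ≤ 27 * (‖z‖ ^ 4 * (‖a‖ ^ 4 + ‖b‖ ^ 4)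
      + (‖z‖ ^ 2 - v) ^ 4 * ‖d‖ ^ 4) := by
  have h : ‖increment v a b d z‖ ≤ ‖z‖ * ‖a‖ + ‖z‖ * ‖b‖ + |‖z‖ ^ 2 - v| * ‖d‖ := by
    refine (norm_add₃_le).trans ?_
    simp only [norm_mul, norm_star, Complex.norm_real, Real.norm_eq_abs]
    rw [mul_comm ‖b‖]
  have h3 : ∀ p q r : ℝ, (p + q + r) ^ 4 ≤ 27 * (p ^ 4 + q ^ 4 + r ^ 4) := fun p q r => by
    have h1 : (p + q + r) ^ 2 ≤ 3 * (p ^ 2 + q ^ 2 + r ^ 2) := by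
      nlinarith [sq_nonneg (p - q), sq_nonneg (p - r), sq_nonneg (q - r)]
    have h2 : ((p + q + r) ^ 2) ^ 2 ≤ (3 * (p ^ 2 + q ^ 2 + r ^ 2)) ^ 2 :=
      pow_le_pow_left₀ (sq_nonneg _) h1 2
    nlinarith [sq_nonneg (p ^ 2 - q ^ 2), sq_nonneg (p ^ 2 - r ^ 2), sq_nonneg (q ^ 2 - r ^ 2)]
  refine (pow_le_pow_left₀ (norm_nonneg _) h 4).trans ((h3 _ _ _).trans (le_of_eq ?_))
  rw [mul_pow, mul_pow, mul_pow, Even.pow_abs (by decide)]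
  ring

theorem HasMoments.memLp [IsProbabilityMeasure μ] {κ v : ℝ} {z : Ω → ℂ}
    (h : HasMoments μ κ v z) : MemLp z (8 : ℕ) μ := by
  rw [← integrable_norm_rpow_iff h.measurable.aestronglyMeasurable (by simp) (by simp)]
  simpa using h.integrable

theorem HasMoments.integrable_pow [IsProbabilityMeasure μ] {κ v : ℝ} {z : Ω → ℂ}
    (h : HasMoments μ κ v z) {k : ℕ} (hk : k ≤ 8) : Integrable (fun ω => ‖z ω‖ ^ k) μ :=
  (h.memLp.mono_exponent (by exact_mod_cast hk)).integrable_norm_pow'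

theorem HasMoments.integrable_centred [IsProbabilityMeasure μ] {κ v : ℝ} {z : Ω → ℂ}
    (h : HasMoments μ κ v z) : Integrable (fun ω => (‖z ω‖ ^ 2 - v) ^ 4) μ := by
  have e : (fun ω => (‖z ω‖ ^ 2 - v) ^ 4) = fun ω => ‖z ω‖ ^ 8 - 4 * v * ‖z ω‖ ^ 6
      + 6 * v ^ 2 * ‖z ω‖ ^ 4 - 4 * v ^ 3 * ‖z ω‖ ^ 2 + v ^ 4 := by
    funext ω
    ring
  rw [e]
  exact ((((h.integrable).sub ((h.integrable_pow (k := 6) (by norm_num)).const_mul _)).add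
    ((h.integrable_pow (k := 4) (by norm_num)).const_mul _)).sub
    ((h.integrable_pow (k := 2) (by norm_num)).const_mul _)).add (integrable_const _)

theorem HasMoments.integral_increment [IsProbabilityMeasure μ] {κ v : ℝ} {z : Ω → ℂ}
    (h : HasMoments μ κ v z) (a b d : ℂ) : ∫ ω, increment v a b d (z ω) ∂μ = 0 := by
  have hz : Integrable z μ := h.memLp.integrable (by norm_num)
  have hzs : Integrable (fun ω => star (z ω)) μ :=
    (LinearIsometryEquiv.integrable_comp_iff Complex.conjLIE).2 hz
  have hs : ∫ ω, star (z ω) ∂μ = 0 := by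
    have := integral_conj (μ := μ) (𝕜 := ℂ) (f := z)
    rw [h.mean, map_zero] at this
    exact this
  have h2 : Integrable (fun ω => ‖z ω‖ ^ 2 - v) μ :=
    (h.integrable_pow (k := 2) (by norm_num)).sub (integrable_const _)
  have hc : ∫ ω, (‖z ω‖ ^ 2 - v) ∂μ = 0 := by
    rw [integral_sub (h.integrable_pow (k := 2) (by norm_num)) (integrable_const _), h.variance]
    simp
  have h3 : Integrable (fun ω => ((‖z ω‖ ^ 2 - v : ℝ) : ℂ)) μ := h2.ofReal
  have h4 : Integrable (fun ω => star (z ω) * a + b * z ω) μ :=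
    (hzs.mul_const a).add (hz.const_mul b)
  unfold increment
  rw [integral_add h4 (h3.mul_const d),
    integral_add (hzs.mul_const a) (hz.const_mul b), integral_mul_const, integral_const_mul,
    integral_mul_const, hs, h.mean, integral_complex_ofReal, hc]
  simp

theorem HasMoments.measurable_increment {κ v : ℝ} {z : Ω → ℂ} (h : HasMoments μ κ v z)
    (a b d : ℂ) : Measurable fun ω => increment v a b d (z ω) :=
  (RandomMatrix.measurable_increment v).comp
    (measurable_const (a := ((a, b, d) : ℂ × ℂ × ℂ)).prodMk h.measurable)

theorem HasMoments.integrable_increment [IsProbabilityMeasure μ] {κ v : ℝ} {z : Ω → ℂ}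
    (h : HasMoments μ κ v z) (a b d : ℂ) :
    Integrable (fun ω => ‖increment v a b d (z ω)‖ ^ 4) μ ∧
    ∫ ω, ‖increment v a b d (z ω)‖ ^ 4 ∂μ
      ≤ 27 * κ * (v ^ 2 * (‖a‖ ^ 4 + ‖b‖ ^ 4) + v ^ 4 * ‖d‖ ^ 4) := by
  have h4 := h.integrable_pow (k := 4) (by norm_num)
  have hint : Integrable (fun ω => 27 * (‖z ω‖ ^ 4 * (‖a‖ ^ 4 + ‖b‖ ^ 4)
      + (‖z ω‖ ^ 2 - v) ^ 4 * ‖d‖ ^ 4)) μ :=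
    ((h4.mul_const _).add (h.integrable_centred.mul_const _)).const_mul _
  have hm := h.measurable_increment a b d
  have hI : Integrable (fun ω => ‖increment v a b d (z ω)‖ ^ 4) μ :=
    hint.mono' (hm.norm.pow_const 4).aestronglyMeasurable (ae_of_all _ fun ω => by
      rw [Real.norm_of_nonneg (by positivity)]
      exact norm_increment_pow_four_le _ _ _ _ _)
  refine ⟨hI, (integral_mono hI hint fun ω => norm_increment_pow_four_le _ _ _ _ _).trans ?_⟩
  rw [integral_const_mul, integral_add (h4.mul_const _) (h.integrable_centred.mul_const _),
    integral_mul_const, integral_mul_const]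
  have e1 := mul_le_mul_of_nonneg_right h.fourth (by positivity : 0 ≤ ‖a‖ ^ 4 + ‖b‖ ^ 4)
  have e2 := mul_le_mul_of_nonneg_right h.centred (by positivity : 0 ≤ ‖d‖ ^ 4)
  linarith

/-- One step of the fourth moment recursion: a new independent variable `z` is added. -/
theorem lintegral_norm_add_increment_pow_four_le [IsProbabilityMeasure μ] {κ v : ℝ} {z : Ω → ℂ}
    (h : HasMoments μ κ v z) (hκ : 0 ≤ κ) {S a b : Ω → ℂ} (hS : Measurable S) (ha : Measurable a)
    (hb : Measurable b) (hind : IndepFun (fun ω => (S ω, a ω, b ω)) z μ) (d : ℂ)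
    {t : ℝ} (ht : 0 < t) (ht1 : t ≤ 1) {s A B : ℝ} (hs0 : 0 ≤ s) (hA0 : 0 ≤ A) (hB0 : 0 ≤ B)
    (hs : ∫⁻ ω, ENNReal.ofReal (‖S ω‖ ^ 4) ∂μ ≤ ENNReal.ofReal s)
    (hA : ∫⁻ ω, ENNReal.ofReal (‖a ω‖ ^ 4) ∂μ ≤ ENNReal.ofReal A)
    (hB : ∫⁻ ω, ENNReal.ofReal (‖b ω‖ ^ 4) ∂μ ≤ ENNReal.ofReal B) :
    ∫⁻ ω, ENNReal.ofReal (‖S ω + increment v (a ω) (b ω) d (z ω)‖ ^ 4) ∂μ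
      ≤ ENNReal.ofReal ((1 + t) * s
        + 19 / t * (27 * κ * (v ^ 2 * (A + B) + v ^ 4 * ‖d‖ ^ 4))) := by
  have hm : Measurable (Function.uncurry fun (p : ℂ × ℂ × ℂ) (x : ℂ) =>
      ENNReal.ofReal (‖p.1 + increment v p.2.1 p.2.2 d x‖ ^ 4)) := by
    refine ENNReal.measurable_ofReal.comp (Continuous.measurable ?_)
    unfold increment
    fun_prop
  -- With `S`, `a`, `b` frozen, the increment is a centred function of `z` alone.
  rw [lintegral_comp_indepFun (hS.prodMk (ha.prodMk hb)) h.measurable hind hm]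
  set c := 19 / t * (27 * κ * v ^ 2) with hc
  set e := 19 / t * (27 * κ * (v ^ 4 * ‖d‖ ^ 4)) with he
  have hc0 : 0 ≤ c := by positivity
  have he0 : 0 ≤ e := by positivity
  calc ∫⁻ ω, ∫⁻ ω', ENNReal.ofReal (‖S ω + increment v (a ω) (b ω) d (z ω')‖ ^ 4) ∂μ ∂μ
      ≤ ∫⁻ ω, (ENNReal.ofReal (1 + t) * ENNReal.ofReal (‖S ω‖ ^ 4)
        + ENNReal.ofReal c * ENNReal.ofReal (‖a ω‖ ^ 4)
        + ENNReal.ofReal c * ENNReal.ofReal (‖b ω‖ ^ 4) + ENNReal.ofReal e) ∂μ := by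
        refine lintegral_mono fun ω => ?_
        obtain ⟨h1, h2⟩ := h.integrable_increment (a ω) (b ω) d
        refine (lintegral_norm_const_add_pow_four_le (S ω) (h.measurable_increment _ _ _) (h.integral_increment _ _ _) h1 h2
          ht ht1).trans (le_of_eq ?_)
        rw [← ENNReal.ofReal_mul (by positivity), ← ENNReal.ofReal_mul hc0,
          ← ENNReal.ofReal_mul hc0, ← ENNReal.ofReal_add (by positivity) (by positivity),
          ← ENNReal.ofReal_add (by positivity) (by positivity),
          ← ENNReal.ofReal_add (by positivity) (by positivity)]
        congr 1
        rw [hc, he]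
        ring
    _ = ENNReal.ofReal (1 + t) * ∫⁻ ω, ENNReal.ofReal (‖S ω‖ ^ 4) ∂μ
        + ENNReal.ofReal c * ∫⁻ ω, ENNReal.ofReal (‖a ω‖ ^ 4) ∂μ
        + ENNReal.ofReal c * ∫⁻ ω, ENNReal.ofReal (‖b ω‖ ^ 4) ∂μ + ENNReal.ofReal e := by
        rw [lintegral_add_right _ measurable_const,
          lintegral_add_right _ (((hb.norm.pow_const 4).ennreal_ofReal).const_mul _),
          lintegral_add_right _ (((ha.norm.pow_const 4).ennreal_ofReal).const_mul _),
          lintegral_const_mul _ (hS.norm.pow_const 4).ennreal_ofReal,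
          lintegral_const_mul _ (ha.norm.pow_const 4).ennreal_ofReal,
          lintegral_const_mul _ (hb.norm.pow_const 4).ennreal_ofReal]
        simp
    _ ≤ ENNReal.ofReal (1 + t) * ENNReal.ofReal s + ENNReal.ofReal c * ENNReal.ofReal A
        + ENNReal.ofReal c * ENNReal.ofReal B + ENNReal.ofReal e := by gcongr
    _ = _ := by
        rw [← ENNReal.ofReal_mul (by positivity), ← ENNReal.ofReal_mul hc0,
          ← ENNReal.ofReal_mul hc0, ← ENNReal.ofReal_add (by positivity) (by positivity),
          ← ENNReal.ofReal_add (by positivity) (by positivity),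
          ← ENNReal.ofReal_add (by positivity) (by positivity)]
        congr 1
        rw [hc, he]
        ring

end Moments

/-! ### Fourth moments of linear and quadratic forms. -/

section Forms

variable {Ω : Type*} [MeasurableSpace Ω] {μ : Measure Ω} {ι : Type*} [DecidableEq ι]

/-- Setting the variables outside `s` to zero keeps the index type `ι`, so any measurable function
of the whole family that only reads `s` can be composed with it. -/
theorem indepFun_restrict {ζ : ι → Ω → ℂ} (hm : ∀ i, Measurable (ζ i)) (hind : iIndepFun ζ μ)
    {s : Finset ι} {k : ι} (hk : k ∉ s) :
    IndepFun (fun ω i => if i ∈ s then ζ i ω else 0) (ζ k) μ := by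
  have h := hind.indepFun_finset s {k} (Finset.disjoint_singleton_right.2 hk) hm
  have hφ : Measurable fun (p : s → ℂ) (i : ι) => if h : i ∈ s then p ⟨i, h⟩ else 0 := by
    refine measurable_pi_iff.2 fun i => ?_
    by_cases hi : i ∈ s
    · simpa [hi] using measurable_pi_apply _
    · simp [hi]
  have hψ : Measurable fun p : (({k} : Finset ι) → ℂ) => p ⟨k, Finset.mem_singleton_self k⟩ :=
    measurable_pi_apply _
  have h2 : IndepFun _ (ζ k) μ := h.comp hφ hψ
  convert h2 using 1
  funext ω i
  simp [dite_eq_ite]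

/-- Discrete Grönwall: `G T exp T` dominates the recursion `X ↦ (1 + t) X + G t` when the time `T`
advances by `t`. -/
theorem gronwall_step {G T t : ℝ} (hG : 0 ≤ G) (hT : 0 ≤ T) (ht : 0 ≤ t) :
    (1 + t) * (G * T * Real.exp T) + G * t ≤ G * (T + t) * Real.exp (T + t) := by
  have h1 : 1 + t ≤ Real.exp t := by linarith [Real.add_one_le_exp t]
  have h2 : 1 ≤ Real.exp (T + t) := Real.one_le_exp (by positivity)
  have h3 : (1 + t) * (G * T * Real.exp T) ≤ Real.exp t * (G * T * Real.exp T) :=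
    mul_le_mul_of_nonneg_right h1 (by positivity)
  have h4 : G * t * 1 ≤ G * t * Real.exp (T + t) :=
    mul_le_mul_of_nonneg_left h2 (by positivity)
  have h5 : Real.exp (T + t) = Real.exp T * Real.exp t := Real.exp_add T t
  rw [h5] at h4 ⊢
  linarith

theorem mul_exp_le_three {G T : ℝ} (hG : 0 ≤ G) (_hT : 0 ≤ T) (hT1 : T ≤ 1) :
    G * T * Real.exp T ≤ 3 * G := by
  have h1 : Real.exp T ≤ 3 :=
    (Real.exp_le_exp.2 hT1).trans (by linarith [Real.exp_one_lt_d9])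
  calc G * T * Real.exp T ≤ G * 1 * 3 := by gcongr
    _ = 3 * G := by ring

variable [IsProbabilityMeasure μ] {κ v : ℝ} {ζ : ι → Ω → ℂ}

/-- The Grönwall time is the share of `β ^ 2` used so far. With `t = ‖c k‖² / β²` the new term `‖c
k‖⁴ / t` equals `β⁴ t`, linear in `t` as required. -/
theorem lintegral_linearForm_aux (hζ : ∀ i, HasMoments μ κ v (ζ i)) (hκ : 0 ≤ κ)
    (hind : iIndepFun ζ μ) (c : ι → ℂ) {β : ℝ} (hβ : 0 < β) (s : Finset ι)
    (hc : ∑ i ∈ s, ‖c i‖ ^ 2 ≤ β ^ 2) :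
    ∫⁻ ω, ENNReal.ofReal (‖∑ i ∈ s, c i * ζ i ω‖ ^ 4) ∂μ
      ≤ ENNReal.ofReal ((19 * (27 * κ * v ^ 2) * β ^ 4) * ((∑ i ∈ s, ‖c i‖ ^ 2) / β ^ 2)
        * Real.exp ((∑ i ∈ s, ‖c i‖ ^ 2) / β ^ 2)) := by
  induction s using Finset.induction_on with
  | empty => simp
  | insert k s hk ih =>
    rw [Finset.sum_insert hk] at hc
    have ih := ih (le_trans (by linarith [sq_nonneg ‖c k‖]) hc)
    simp only [Finset.sum_insert hk]
    -- A zero coefficient would give `t = 0`, which the one-step bound excludes.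
    rcases eq_or_ne (c k) 0 with h0 | h0
    · simpa [h0] using ih
    set T := (∑ i ∈ s, ‖c i‖ ^ 2) / β ^ 2 with hT
    set t := ‖c k‖ ^ 2 / β ^ 2 with ht
    have ht0 : 0 < t := by positivity
    have ht1 : t ≤ 1 := by
      rw [ht, div_le_one (by positivity)]
      exact le_trans (by linarith [Finset.sum_nonneg fun i (_ : i ∈ s) => sq_nonneg ‖c i‖]) hc
    have hT0 : 0 ≤ T := by positivity
    have hSm : Measurable fun ω => ∑ i ∈ s, c i * ζ i ω :=
      Finset.measurable_sum _ fun i _ => (hζ i).measurable.const_mul _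
    have hI : IndepFun (fun ω => ((∑ i ∈ s, c i * ζ i ω, 0, c k) : ℂ × ℂ × ℂ)) (ζ k) μ := by
      have hg : Measurable fun x : ι → ℂ => ((∑ i ∈ s, c i * x i, 0, c k) : ℂ × ℂ × ℂ) := by
        fun_prop
      have : IndepFun _ (ζ k) μ := (indepFun_restrict (fun i => (hζ i).measurable) hind hk).comp hg measurable_id
      convert this using 1
      funext ω
      simp only [Function.comp]
      congr 1
      exact Finset.sum_congr rfl fun i hi => by simp [hi]
    have key := lintegral_norm_add_increment_pow_four_le (hζ k) hκ hSm
      (measurable_const (a := (0 : ℂ))) (measurable_const (a := c k)) hI 0 ht0 ht1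
      (s := 19 * (27 * κ * v ^ 2) * β ^ 4 * T * Real.exp T) (A := 0) (B := ‖c k‖ ^ 4)
      (by positivity) le_rfl (by positivity) ih (by simp) (by simp)
    have e : ∀ ω, c k * ζ k ω + ∑ i ∈ s, c i * ζ i ω
        = (∑ i ∈ s, c i * ζ i ω) + increment v 0 (c k) 0 (ζ k ω) := fun ω => by
      simp [increment, add_comm]
    simp only [e]
    refine key.trans (ENNReal.ofReal_le_ofReal ?_)
    have e2 : (‖c k‖ ^ 2 + ∑ i ∈ s, ‖c i‖ ^ 2) / β ^ 2 = T + t := by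
      rw [hT, ht]
      ring
    have e3 : ‖c k‖ ^ 4 = (t * β ^ 2) ^ 2 := by
      rw [ht]
      field_simp
    rw [e2, e3]
    refine le_trans (le_of_eq ?_) (gronwall_step (by positivity) (by positivity) ht0.le)
    simp only [norm_zero]
    field_simp
    ring

theorem lintegral_linearForm_le (hζ : ∀ i, HasMoments μ κ v (ζ i)) (hκ : 0 ≤ κ)
    (hind : iIndepFun ζ μ) (c : ι → ℂ) {β : ℝ} (hβ : 0 < β) (s : Finset ι)
    (hc : ∑ i ∈ s, ‖c i‖ ^ 2 ≤ β ^ 2) :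
    ∫⁻ ω, ENNReal.ofReal (‖∑ i ∈ s, c i * ζ i ω‖ ^ 4) ∂μ
      ≤ ENNReal.ofReal (1539 * κ * v ^ 2 * β ^ 4) := by
  refine (lintegral_linearForm_aux hζ hκ hind c hβ s hc).trans (ENNReal.ofReal_le_ofReal ?_)
  refine (mul_exp_le_three (by positivity) (by positivity) ?_).trans (le_of_eq (by ring))
  exact div_le_one_of_le₀ hc (by positivity)

/-- Adding the index `k` contributes an increment whose coefficients are linear forms in the earlier
variables, given by row and column `k` of `B`. The linear bound controls them uniformly in `k`, so
equal time steps `1 / n` suffice; `n` stays fixed while `s` grows. The constant `3078` is `2 *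
1539`, one share for the row and one for the column. -/
theorem lintegral_quadraticForm_aux [Finite ι] (hζ : ∀ i, HasMoments μ κ v (ζ i)) (hκ : 0 ≤ κ)
    (hind : iIndepFun ζ μ) (B : ι → ι → ℂ) {β : ℝ} (hβ : 0 < β) {s : Finset ι}
    (hrow : ∀ i ∈ s, ∑ j ∈ s, ‖B i j‖ ^ 2 ≤ β ^ 2) (hcol : ∀ j ∈ s, ∑ i ∈ s, ‖B i j‖ ^ 2 ≤ β ^ 2)
    {n : ℕ} (hn : s.card ≤ n) :
    ∫⁻ ω, ENNReal.ofReal (‖∑ i ∈ s, ∑ j ∈ s, star (ζ i ω) * B i j * ζ j ω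
        - v * ∑ i ∈ s, B i i‖ ^ 4) ∂μ
      ≤ ENNReal.ofReal ((19 * (27 * κ * (3078 * κ + 1) * v ^ 4 * β ^ 4) * n ^ 2) * (s.card / n)
        * Real.exp (s.card / n)) := by
  induction s using Finset.induction_on with
  | empty => simp
  | insert k s hk ih =>
    have hsub : ∀ f : ι → ℝ, ∑ i ∈ s, f i ^ 2 ≤ ∑ i ∈ insert k s, f i ^ 2 := fun f => by
      rw [Finset.sum_insert hk]
      linarith [sq_nonneg (f k)]
    rw [Finset.card_insert_of_notMem hk] at hn ⊢
    have ih := ih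
      (fun i hi => (hsub fun j => ‖B i j‖).trans (hrow i (Finset.mem_insert_of_mem hi)))
      (fun j hj => (hsub fun i => ‖B i j‖).trans (hcol j (Finset.mem_insert_of_mem hj)))
      (by omega)
    have hrk : ∑ j ∈ s, ‖B k j‖ ^ 2 ≤ β ^ 2 :=
      (hsub fun j => ‖B k j‖).trans (hrow k (Finset.mem_insert_self k s))
    have hck : ∑ i ∈ s, ‖star (B i k)‖ ^ 2 ≤ β ^ 2 := by
      simp only [norm_star]
      exact (hsub fun i => ‖B i k‖).trans (hcol k (Finset.mem_insert_self k s))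
    have hkk : ‖B k k‖ ^ 4 ≤ β ^ 4 := by
      have h1 : ‖B k k‖ ^ 2 ≤ β ^ 2 := by
        have := hrow k (Finset.mem_insert_self k s)
        rw [Finset.sum_insert hk] at this
        linarith [Finset.sum_nonneg fun i (_ : i ∈ s) => sq_nonneg ‖B k i‖]
      have h2 := pow_le_pow_left₀ (sq_nonneg _) h1 2
      rw [← pow_mul, ← pow_mul] at h2
      exact h2
    have hζm := fun i => (hζ i).measurable
    set S : Ω → ℂ := fun ω => ∑ i ∈ s, ∑ j ∈ s, star (ζ i ω) * B i j * ζ j ω - v * ∑ i ∈ s, B i i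
      with hS
    set a : Ω → ℂ := fun ω => ∑ j ∈ s, B k j * ζ j ω with ha
    -- The column sum involves conjugated variables; as the conjugate of a linear form it falls
    -- under the same bound.
    set b : Ω → ℂ := fun ω => star (∑ i ∈ s, star (B i k) * ζ i ω) with hb
    have hg : Measurable fun x : ι → ℂ => ((∑ i ∈ s, ∑ j ∈ s, star (x i) * B i j * x j
        - v * ∑ i ∈ s, B i i, ∑ j ∈ s, B k j * x j, star (∑ i ∈ s, star (B i k) * x i)) :
        ℂ × ℂ × ℂ) := by
      refine Measurable.prodMk ?_ (Measurable.prodMk ?_ ?_)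
      all_goals
        refine Continuous.measurable ?_
        fun_prop
    have hgm : Measurable fun ω => (S ω, a ω, b ω) :=
      hg.comp (measurable_pi_iff.2 hζm)
    have hI : IndepFun (fun ω => (S ω, a ω, b ω)) (ζ k) μ := by
      have : IndepFun _ (ζ k) μ := (indepFun_restrict hζm hind hk).comp hg measurable_id
      convert this using 1
      funext ω
      simp only [Function.comp, hS, ha, hb]
      refine congrArg₂ Prod.mk (congrArg₂ _ (Finset.sum_congr rfl fun i hi =>
        Finset.sum_congr rfl fun j hj => ?_) rfl) (congrArg₂ Prod.mk (Finset.sum_congr rfl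
        fun j hj => ?_) (congrArg _ (Finset.sum_congr rfl fun i hi => ?_)))
      · simp [hi, hj]
      · simp [hj]
      · simp [hi]
    have hn0 : 0 < n := by omega
    have hnR : (1 : ℝ) ≤ n := by exact_mod_cast hn0
    set t : ℝ := 1 / n with ht
    have ht0 : 0 < t := by positivity
    have ht1 : t ≤ 1 := by
      rw [ht, div_le_one (by linarith)]
      exact hnR
    have key := lintegral_norm_add_increment_pow_four_le (hζ k) hκ hgm.fst hgm.snd.fst hgm.snd.snd
      hI (B k k) ht0 ht1 (by positivity)
      (by positivity : 0 ≤ 1539 * κ * v ^ 2 * β ^ 4) (by positivity : 0 ≤ 1539 * κ * v ^ 2 * β ^ 4)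
      ih (lintegral_linearForm_le hζ hκ hind _ hβ s hrk)
      (by simpa only [hb, norm_star] using lintegral_linearForm_le hζ hκ hind _ hβ s hck)
    have e : ∀ ω, ∑ i ∈ insert k s, ∑ j ∈ insert k s, star (ζ i ω) * B i j * ζ j ω
        - v * ∑ i ∈ insert k s, B i i = S ω + increment v (a ω) (b ω) (B k k) (ζ k ω) := fun ω => by
      have hz : star (ζ k ω) * ζ k ω = ((‖ζ k ω‖ ^ 2 : ℝ) : ℂ) := by
        have := Complex.conj_mul' (ζ k ω)
        push_cast
        exact this
      simp only [Finset.sum_insert hk, increment, hS, ha, hb, star_sum, star_mul', star_star,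
        Finset.sum_add_distrib, Finset.mul_sum, Finset.sum_mul]
      rw [Finset.sum_congr rfl fun (i : ι) _ =>
        (by ring : star (ζ k ω) * B k i * ζ i ω = star (ζ k ω) * (B k i * ζ i ω)),
        Finset.sum_congr rfl fun (i : ι) _ =>
        (by ring : star (ζ i ω) * B i k * ζ k ω = B i k * star (ζ i ω) * ζ k ω)]
      push_cast at hz ⊢
      linear_combination B k k * hz - Finset.mul_sum s (fun i => B i i) (v : ℂ)
    simp only [e]
    refine key.trans (ENNReal.ofReal_le_ofReal ?_)
    have e2 : ((s.card + 1 : ℕ) : ℝ) / n = s.card / n + t := by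
      rw [ht]
      push_cast
      ring
    rw [e2]
    refine le_trans ?_ (gronwall_step (by positivity) (by positivity) ht0.le)
    refine add_le_add_right ?_ _
    calc _ ≤ 19 / t * (27 * κ * (v ^ 2 * (1539 * κ * v ^ 2 * β ^ 4 + 1539 * κ * v ^ 2 * β ^ 4)
          + v ^ 4 * β ^ 4)) := by gcongr
      _ = _ := by
        rw [ht]
        field_simp
        ring

/-- Fourth moment bound for a centred quadratic form in independent variables. -/
theorem lintegral_quadraticForm_le [Fintype ι] (hζ : ∀ i, HasMoments μ κ v (ζ i)) (hκ : 0 ≤ κ)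
    (hind : iIndepFun ζ μ) (B : ι → ι → ℂ) {β : ℝ} (hβ : 0 < β)
    (hrow : ∀ i, ∑ j, ‖B i j‖ ^ 2 ≤ β ^ 2) (hcol : ∀ j, ∑ i, ‖B i j‖ ^ 2 ≤ β ^ 2) :
    ∫⁻ ω, ENNReal.ofReal (‖∑ i, ∑ j, star (ζ i ω) * B i j * ζ j ω - v * ∑ i, B i i‖ ^ 4) ∂μ
      ≤ ENNReal.ofReal (1539 * κ * (3078 * κ + 1) * v ^ 4 * β ^ 4 * Fintype.card ι ^ 2) := by
  refine (lintegral_quadraticForm_aux hζ hκ hind B hβ (fun i _ => hrow i) (fun j _ => hcol j)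
    (n := Fintype.card ι) le_rfl).trans (ENNReal.ofReal_le_ofReal ?_)
  refine (mul_exp_le_three (by positivity) (by positivity) ?_).trans (le_of_eq (by ring))
  exact div_self_le_one _

end Forms

/-! ### Measurability of matrix operations, and norm bounds for rows, columns and traces. -/

instance instBorelSpaceMatrix {m n : Type*} [Countable m] [Countable n] :
    BorelSpace (Matrix m n ℂ) :=
  (inferInstance : BorelSpace (m → n → ℂ))

theorem measurable_matrix_mul {E : Type*} [MeasurableSpace E] {m : ℕ}
    {f g : E → Matrix (Fin m) (Fin m) ℂ} (hf : Measurable f) (hg : Measurable g) :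
    Measurable fun e => f e * g e := by
  refine measurable_pi_iff.2 fun i => measurable_pi_iff.2 fun j => ?_
  simp only [Matrix.mul_apply]
  exact Finset.measurable_sum _ fun k _ =>
    ((measurable_pi_apply k).comp ((measurable_pi_apply i).comp hf)).mul
      ((measurable_pi_apply j).comp ((measurable_pi_apply k).comp hg))

theorem measurable_matrix_inv {E : Type*} [MeasurableSpace E] {m : ℕ}
    {f : E → Matrix (Fin m) (Fin m) ℂ} (hf : Measurable f) : Measurable fun e => (f e)⁻¹ := by
  have h1 : Measurable fun A : Matrix (Fin m) (Fin m) ℂ => A.det :=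
    (continuous_id.matrix_det).measurable
  have h2 : Measurable fun A : Matrix (Fin m) (Fin m) ℂ => A.adjugate :=
    (continuous_id.matrix_adjugate).measurable
  refine measurable_pi_iff.2 fun i => measurable_pi_iff.2 fun j => ?_
  simp only [Matrix.inv_def, Ring.inverse_eq_inv', Matrix.smul_apply, smul_eq_mul]
  exact (h1.comp hf).inv.mul
    ((measurable_pi_apply j).comp ((measurable_pi_apply i).comp (h2.comp hf)))

theorem measurable_matrix_norm {m : ℕ} :
    Measurable fun A : Matrix (Fin m) (Fin m) ℂ => ‖A‖ :=
  continuous_norm.measurable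

theorem sum_col_norm_sq_le {m : ℕ} (B : Matrix (Fin m) (Fin m) ℂ) (j : Fin m) :
    ∑ i, ‖B i j‖ ^ 2 ≤ ‖B‖ ^ 2 := by
  have h := Matrix.l2_opNorm_mulVec B (EuclideanSpace.single j (1 : ℂ))
  rw [PiLp.norm_single, norm_one, mul_one] at h
  have h2 := pow_le_pow_left₀ (norm_nonneg _) h 2
  rw [EuclideanSpace.norm_sq_eq] at h2
  simpa using h2

theorem sum_row_norm_sq_le {m : ℕ} (B : Matrix (Fin m) (Fin m) ℂ) (i : Fin m) :
    ∑ j, ‖B i j‖ ^ 2 ≤ ‖B‖ ^ 2 := by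
  have h := sum_col_norm_sq_le Bᴴ i
  rw [Matrix.l2_opNorm_conjTranspose] at h
  simpa using h

theorem norm_ntr_le {m : ℕ} (B : Matrix (Fin m) (Fin m) ℂ) : ‖ntr B‖ ≤ ‖B‖ := by
  rcases Nat.eq_zero_or_pos m with rfl | hm
  · simp [ntr]
  have h : ‖B.trace‖ ≤ m * ‖B‖ := by
    refine (norm_sum_le _ _).trans ?_
    refine (Finset.sum_le_sum fun i _ => (?_ : ‖B.diag i‖ ≤ ‖B‖)).trans (by simp)
    refine le_of_sq_le_sq ?_ (norm_nonneg _)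
    exact (Finset.single_le_sum (f := fun j => ‖B i j‖ ^ 2) (fun j _ => sq_nonneg _)
      (Finset.mem_univ i)).trans (sum_row_norm_sq_le B i)
  have hm' : (0 : ℝ) < m := by exact_mod_cast hm
  rw [ntr, norm_div, Complex.norm_natCast, div_le_iff₀ hm']
  linarith

/-! ### The trace lemma, almost surely. -/

section Convergence

variable {Ω : Type*} [MeasurableSpace Ω] {μ : Measure Ω}

/-- Both bounds are pointwise comparisons with `‖z‖ ^ 8`: `p ≤ v² + p² / v²` for `p = ‖z‖⁴`, and `(p
- v)⁴ ≤ 8 (p⁴ + v⁴)` for `p = ‖z‖²`. -/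
theorem HasMoments.of_eighth [IsProbabilityMeasure μ] {z : Ω → ℂ} (hz : Measurable z) {v C : ℝ}
    (hv : 0 < v) (h1 : ∫ ω, z ω ∂μ = 0) (h2 : ∫ ω, ‖z ω‖ ^ 2 ∂μ = v)
    (h8 : ∫⁻ ω, ENNReal.ofReal (‖z ω‖ ^ 8) ∂μ ≤ ENNReal.ofReal (C * v ^ 4)) :
    HasMoments μ (8 * (|C| + 1)) v z := by
  have hnn : ∀ ω, 0 ≤ ‖z ω‖ ^ 8 := fun ω => by positivity
  have hm8 : AEStronglyMeasurable (fun ω => ‖z ω‖ ^ 8) μ :=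
    (hz.norm.pow_const 8).aestronglyMeasurable
  have hi : Integrable (fun ω => ‖z ω‖ ^ 8) μ :=
    ⟨hm8, (hasFiniteIntegral_iff_ofReal (ae_of_all _ hnn)).2
      (h8.trans_lt ENNReal.ofReal_lt_top)⟩
  have hI : ∫ ω, ‖z ω‖ ^ 8 ∂μ ≤ |C| * v ^ 4 := by
    rw [integral_eq_lintegral_of_nonneg_ae (ae_of_all _ hnn) hm8]
    refine ENNReal.toReal_le_of_le_ofReal (by positivity) (h8.trans ?_)
    exact ENNReal.ofReal_le_ofReal (mul_le_mul_of_nonneg_right (le_abs_self C) (by positivity))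
  refine ⟨hz, h1, h2, hi, ?_, ?_⟩
  · have hp : ∀ ω, ‖z ω‖ ^ 4 ≤ v ^ 2 + (v ^ 2)⁻¹ * ‖z ω‖ ^ 8 := fun ω => by
      have hq : 0 ≤ (v ^ 2)⁻¹ * ((v ^ 2 - ‖z ω‖ ^ 4) ^ 2 + v ^ 2 * ‖z ω‖ ^ 4) := by positivity
      have e : (v ^ 2)⁻¹ * ((v ^ 2 - ‖z ω‖ ^ 4) ^ 2 + v ^ 2 * ‖z ω‖ ^ 4)
          = v ^ 2 + (v ^ 2)⁻¹ * ‖z ω‖ ^ 8 - ‖z ω‖ ^ 4 := by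
        field_simp
        ring
      linarith
    calc ∫ ω, ‖z ω‖ ^ 4 ∂μ ≤ ∫ ω, (v ^ 2 + (v ^ 2)⁻¹ * ‖z ω‖ ^ 8) ∂μ :=
          integral_mono_of_nonneg (ae_of_all _ fun ω => by positivity)
            ((integrable_const _).add (hi.const_mul _)) (ae_of_all _ hp)
      _ = v ^ 2 + (v ^ 2)⁻¹ * ∫ ω, ‖z ω‖ ^ 8 ∂μ := by
          rw [integral_add (integrable_const _) (hi.const_mul _), integral_const_mul]
          simp
      _ ≤ v ^ 2 + (v ^ 2)⁻¹ * (|C| * v ^ 4) := by gcongr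
      _ = (|C| + 1) * v ^ 2 := by
          field_simp
          ring
      _ ≤ _ := mul_le_mul_of_nonneg_right (by linarith [abs_nonneg C]) (by positivity)
  · have hp : ∀ ω, (‖z ω‖ ^ 2 - v) ^ 4 ≤ 8 * (‖z ω‖ ^ 8 + v ^ 4) := fun ω => by
      set x := ‖z ω‖ ^ 2 with hx
      have h3 : (x - v) ^ 2 ≤ 2 * (x ^ 2 + v ^ 2) := by nlinarith [sq_nonneg (x + v)]
      have h4 := pow_le_pow_left₀ (sq_nonneg _) h3 2
      have h5 : ‖z ω‖ ^ 8 = x ^ 4 := by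
        rw [hx]
        ring
      rw [h5]
      nlinarith [sq_nonneg (x ^ 2 - v ^ 2)]
    calc ∫ ω, (‖z ω‖ ^ 2 - v) ^ 4 ∂μ ≤ ∫ ω, 8 * (‖z ω‖ ^ 8 + v ^ 4) ∂μ :=
          integral_mono_of_nonneg (ae_of_all _ fun ω => by positivity)
            ((hi.add (integrable_const _)).const_mul _) (ae_of_all _ hp)
      _ = 8 * (∫ ω, ‖z ω‖ ^ 8 ∂μ + v ^ 4) := by
          rw [integral_const_mul, integral_add hi (integrable_const _)]
          simp
      _ ≤ 8 * (|C| * v ^ 4 + v ^ 4) := by gcongr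
      _ = _ := by ring

/-- A form in combinations of several vectors is a single quadratic form in all their entries, with
a block matrix whose blocks are multiples of `B`. Thus cross terms between independent vectors need
no separate lemma. -/
theorem sesq_sum_smul {m : ℕ} {J : Type*} [Fintype J] (α α' : J → ℂ) (V : J → Fin m → ℂ)
    (B : Matrix (Fin m) (Fin m) ℂ) :
    sesq (∑ a, α a • V a) B (∑ b, α' b • V b)
      = ∑ p : J × Fin m, ∑ q : J × Fin m,
        star (V p.1 p.2) * (star (α p.1) * α' q.1 * B p.2 q.2) * V q.1 q.2 := by
  simp only [sesq, dotProduct, Matrix.mulVec, Pi.star_apply, Finset.sum_apply, Pi.smul_apply,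
    smul_eq_mul, star_sum, star_mul', Fintype.sum_prod_type, Finset.sum_mul, Finset.mul_sum]
  conv_rhs => rw [Finset.sum_comm]
  refine Finset.sum_congr rfl fun i _ => ?_
  conv_rhs => rw [Finset.sum_comm]
  rw [Finset.sum_comm]
  refine Finset.sum_congr rfl fun b _ => ?_
  rw [Finset.sum_comm]
  exact Finset.sum_congr rfl fun a _ => Finset.sum_congr rfl fun j _ => by ring

theorem ntr_eq_sum {m : ℕ} {J : Type*} [Fintype J] (α α' : J → ℂ)
    (B : Matrix (Fin m) (Fin m) ℂ) :
    (∑ a, star (α a) * α' a) * ntr B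
      = ((1 / (m : ℝ) : ℝ) : ℂ) * ∑ p : J × Fin m, star (α p.1) * α' p.1 * B p.2 p.2 := by
  simp only [ntr, Matrix.trace, Matrix.diag, Fintype.sum_prod_type, ← Finset.mul_sum,
    ← Finset.sum_mul]
  push_cast
  ring

theorem measurable_sesq_truncated {m : ℕ} (α α' : Fin 3 → ℂ) (K : ℝ) :
    Measurable (Function.uncurry fun (A : Matrix (Fin m) (Fin m) ℂ)
      (W : Fin 3 → Fin m → ℂ) => if ‖A‖ ≤ K then ENNReal.ofReal (‖sesq (∑ a, α a • W a) A
        (∑ b, α' b • W b) - (∑ a, star (α a) * α' a) * ntr A‖ ^ 4) else 0) := by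
  have : SecondCountableTopology (Matrix (Fin m) (Fin m) ℂ) :=
    (inferInstance : SecondCountableTopology (Fin m → Fin m → ℂ))
  refine Measurable.ite (measurableSet_le (measurable_matrix_norm.comp measurable_fst)
    measurable_const) (ENNReal.measurable_ofReal.comp (Continuous.measurable ?_))
    measurable_const
  unfold sesq ntr
  fun_prop

/-- The random `B` is frozen by independence, and the truncation makes the deterministic bound
uniform. The constant is `1539 * 2⁴ * 3²`, from `β = 2 * K` and `3 * m` variables. -/
theorem lintegral_sesq_truncated_le [IsProbabilityMeasure μ] {m : ℕ} {κ : ℝ} (hκ : 0 ≤ κ)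
    {V : Fin 3 → Ω → Fin m → ℂ} (hV : ∀ a i, HasMoments μ κ (1 / (m : ℝ)) fun ω => V a ω i)
    (hind : iIndepFun (fun (p : Fin 3 × Fin m) ω => V p.1 ω p.2) μ)
    {B : Ω → Matrix (Fin m) (Fin m) ℂ} (hB : Measurable B)
    (hBV : IndepFun B (fun ω a => V a ω) μ) {α α' : Fin 3 → ℂ} (hα : ∀ a, ‖α a‖ ≤ 1)
    (hα' : ∀ a, ‖α' a‖ ≤ 1) {K : ℝ} (hK : 0 < K) :
    ∫⁻ ω, (if ‖B ω‖ ≤ K then ENNReal.ofReal (‖sesq (∑ a, α a • V a ω) (B ω)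
        (∑ b, α' b • V b ω) - (∑ a, star (α a) * α' a) * ntr (B ω)‖ ^ 4) else 0) ∂μ
      ≤ ENNReal.ofReal (221616 * κ * (3078 * κ + 1) * K ^ 4 * (1 / (m : ℝ) ^ 2)) := by
  have hVm : Measurable fun ω a => V a ω :=
    measurable_pi_iff.2 fun a => measurable_pi_iff.2 fun i => (hV a i).measurable
  rw [lintegral_comp_indepFun hB hVm hBV (measurable_sesq_truncated α α' K)]
  refine (lintegral_mono fun ω => (?_ : _ ≤ ENNReal.ofReal
    (221616 * κ * (3078 * κ + 1) * K ^ 4 * (1 / (m : ℝ) ^ 2)))).trans (by simp)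
  by_cases hω : ‖B ω‖ ≤ K
  swap
  · simp [hω]
  simp only [hω, if_true, sesq_sum_smul, ntr_eq_sum]
  have hentry : ∀ p q : Fin 3 × Fin m, ‖star (α p.1) * α' q.1 * B ω p.2 q.2‖ ^ 2
      ≤ ‖B ω p.2 q.2‖ ^ 2 := fun p q => by
    refine pow_le_pow_left₀ (norm_nonneg _) ?_ 2
    rw [norm_mul, norm_mul, norm_star]
    exact mul_le_of_le_one_left (norm_nonneg _)
      (mul_le_one₀ (hα _) (norm_nonneg _) (hα' _))
  have hK2 : ‖B ω‖ ^ 2 ≤ K ^ 2 := pow_le_pow_left₀ (norm_nonneg _) hω 2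
  have key := lintegral_quadraticForm_le (ζ := fun (p : Fin 3 × Fin m) ω => V p.1 ω p.2)
    (fun p => hV p.1 p.2) hκ hind (fun p q => star (α p.1) * α' q.1 * B ω p.2 q.2)
    -- Three blocks give squared row and column sums of at most `3 K² ≤ (2 K)²`.
    (β := 2 * K) (by positivity)
    (fun p => by
      refine (Finset.sum_le_sum fun q _ => hentry p q).trans ?_
      rw [Fintype.sum_prod_type]
      have := sum_row_norm_sq_le (B ω) p.2
      simp only [Finset.sum_const, Finset.card_univ, Fintype.card_fin, nsmul_eq_mul]
      push_cast
      nlinarith [sq_nonneg K])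
    (fun q => by
      refine (Finset.sum_le_sum fun p _ => hentry p q).trans ?_
      rw [Fintype.sum_prod_type]
      have := sum_col_norm_sq_le (B ω) q.2
      simp only [Finset.sum_const, Finset.card_univ, Fintype.card_fin, nsmul_eq_mul]
      push_cast
      nlinarith [sq_nonneg K])
  refine key.trans (ENNReal.ofReal_le_ofReal (le_of_eq ?_))
  rcases Nat.eq_zero_or_pos m with rfl | hm
  · simp
  simp only [Fintype.card_prod, Fintype.card_fin]
  have hm' : (m : ℝ) ≠ 0 := by positivity
  push_cast
  field_simp
  ring

/-- The sum of the `f N` has finite integral, so it is almost surely finite and its terms tend to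
zero; this takes the place of Markov and Borel–Cantelli. -/
theorem ae_tendsto_zero_of_tsum_lintegral {f : ℕ → Ω → ENNReal} (hf : ∀ N, Measurable (f N))
    {c : ℕ → ℝ} (hc0 : ∀ N, 0 ≤ c N) (hc : Summable c)
    (h : ∀ N, ∫⁻ ω, f N ω ∂μ ≤ ENNReal.ofReal (c N)) :
    ∀ᵐ ω ∂μ, Tendsto (fun N => f N ω) atTop (𝓝 0) := by
  have h1 : ∫⁻ ω, ∑' N, f N ω ∂μ ≠ ⊤ := by
    rw [lintegral_tsum fun N => (hf N).aemeasurable]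
    refine ne_top_of_le_ne_top ?_ (ENNReal.tsum_le_tsum h)
    rw [← ENNReal.ofReal_tsum_of_nonneg hc0 hc]
    exact ENNReal.ofReal_ne_top
  filter_upwards [ae_lt_top (Measurable.tsum hf) h1] with ω hω
  exact ENNReal.tendsto_atTop_zero_of_tsum_ne_top hω.ne

/-- The trace lemma for combinations of independent vectors and an independent bounded random
matrix. -/
theorem asympEq_sesq [IsProbabilityMeasure μ] {M : ℕ → ℕ} (hM : StrictMono M)
    {V : Fin 3 → ∀ N, Ω → Fin (M N) → ℂ} (hV : ∀ a, IsIIDSequence μ M (V a))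
    (hVi : ∀ N, iIndepFun (fun a => V a N) μ) {B : ∀ N, Ω → Matrix (Fin (M N)) (Fin (M N)) ℂ}
    (hBm : ∀ N, Measurable (B N)) (hBV : ∀ N, IndepFun (B N) (fun ω a => V a N ω) μ)
    (hB : AEBounded μ B) {α α' : Fin 3 → ℂ} (hα : ∀ a, ‖α a‖ ≤ 1) (hα' : ∀ a, ‖α' a‖ ≤ 1) :
    AsympEq μ (fun N ω => sesq (∑ a, α a • V a N ω) (B N ω) (∑ b, α' b • V b N ω))
      (fun N ω => (∑ a, star (α a) * α' a) * ntr (B N ω)) := by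
  choose C hC using fun a => (hV a).eighthMoment
  set κ : ℝ := 8 * (|(∑ a, |C a|)| + 1) with hκ
  have hκ0 : 0 ≤ κ := by positivity
  have hmom : ∀ N a i, HasMoments μ κ (1 / (M N : ℝ)) fun ω => V a N ω i := fun N a i => by
    have hm : (0 : ℝ) < M N := by exact_mod_cast i.pos
    refine HasMoments.of_eighth ((measurable_pi_apply i).comp ((hV a).measurable N))
      (by positivity) ((hV a).mean N i) ((hV a).variance N i) ((hC a N i).trans ?_)
    refine ENNReal.ofReal_le_ofReal ?_
    rw [one_div, inv_pow, ← div_eq_mul_inv]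
    gcongr
    exact (le_abs_self _).trans
      (Finset.single_le_sum (f := fun a => |C a|) (fun _ _ => abs_nonneg _) (Finset.mem_univ a))
  have hind : ∀ N, iIndepFun (fun (p : Fin 3 × Fin (M N)) ω => V p.1 N ω p.2) μ := fun N =>
    iIndepFun_uncurry' (X := fun a i ω => V a N ω i) (fun a i => (hmom N a i).measurable)
      (hVi N) (fun a => (hV a).indep N)
  have hVm : ∀ N a, Measurable (V a N) := fun N a => (hV a).measurable N
  -- The norm bound on `B` depends on `ω`. Integer truncation levels leave countably many null sets,
  -- and the level is chosen afterwards for each `ω`.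
  have hconv : ∀ K : ℕ, ∀ᵐ ω ∂μ, Tendsto (fun N => if ‖B N ω‖ ≤ (K + 1 : ℝ) then
      ENNReal.ofReal (‖sesq (∑ a, α a • V a N ω) (B N ω) (∑ b, α' b • V b N ω)
        - (∑ a, star (α a) * α' a) * ntr (B N ω)‖ ^ 4) else 0) atTop (𝓝 0) := fun K => by
    have hK : (0 : ℝ) < K + 1 := by positivity
    refine ae_tendsto_zero_of_tsum_lintegral
      (c := fun N => 221616 * κ * (3078 * κ + 1) * (K + 1 : ℝ) ^ 4 * (1 / (M N : ℝ) ^ 2))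
      (fun N => ?_) (fun N => ?_) ?_ (fun N => ?_)
    · have h1 : Measurable fun ω => (B N ω, fun a => V a N ω) :=
        (hBm N).prodMk (measurable_pi_iff.2 (hVm N))
      have h2 := (measurable_sesq_truncated α α' (K + 1 : ℝ)).comp h1
      simp only [Function.comp_def, Function.uncurry_apply_pair] at h2
      exact h2
    · positivity
    -- Distinct dimensions make this a subseries of `∑ 1 / n²`; a possible dimension `0` contributes
    -- `1 / 0 = 0`.
    · exact ((Real.summable_one_div_nat_pow.2 one_lt_two).comp_injective hM.injective).mul_left _
    · exact lintegral_sesq_truncated_le hκ0 (V := fun a => V a N) (hmom N) (hind N) (hBm N)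
        (hBV N) hα hα' hK
  filter_upwards [ae_all_iff.2 hconv, hB] with ω h1 ⟨C', hC'⟩
  obtain ⟨K, hK⟩ := exists_nat_ge C'
  have h2 := h1 K
  simp only [fun N => (hC' N).trans (hK.trans (by linarith : (K : ℝ) ≤ K + 1)), if_true] at h2
  have h3 := (ENNReal.tendsto_toReal ENNReal.zero_ne_top).comp h2
  have h4 := ((Real.continuous_sqrt.comp Real.continuous_sqrt).tendsto' 0 0 (by simp)).comp h3
  rw [tendsto_zero_iff_norm_tendsto_zero]
  have h5 : ∀ x : ℝ, x ^ 4 = (x ^ 2) ^ 2 := fun x => by ring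
  refine h4.congr fun N => ?_
  simp only [Function.comp]
  rw [ENNReal.toReal_ofReal (by positivity), h5,
    Real.sqrt_sq (by positivity), Real.sqrt_sq (norm_nonneg _)]

end Convergence

/-! ### Square roots of `Θ` and rank-one perturbations. -/

section LinearAlgebra

variable {m : ℕ}

theorem sesq_correlated {Θ : Matrix (Fin m) (Fin m) ℂ} (x y : Fin m → ℂ)
    (B : Matrix (Fin m) (Fin m) ℂ) :
    sesq (correlated Θ x) B (correlated Θ y) = sesq x (CFC.sqrt Θ * B * CFC.sqrt Θ) y := by
  have h : (CFC.sqrt Θ)ᴴ = CFC.sqrt Θ := (CFC.sqrt_nonneg Θ).isSelfAdjoint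
  simp only [sesq, correlated, Matrix.star_mulVec, h, Matrix.dotProduct_mulVec,
    Matrix.vecMul_vecMul, Matrix.mul_assoc]

theorem sqrt_mul_sqrt_of_posSemidef {Θ : Matrix (Fin m) (Fin m) ℂ} (hΘ : Θ.PosSemidef) :
    CFC.sqrt Θ * CFC.sqrt Θ = Θ :=
  CFC.sqrt_mul_sqrt_self Θ hΘ.nonneg

theorem ntr_sqrt_mul_mul_sqrt {Θ : Matrix (Fin m) (Fin m) ℂ} (hΘ : Θ.PosSemidef)
    (B : Matrix (Fin m) (Fin m) ℂ) : ntr (CFC.sqrt Θ * B * CFC.sqrt Θ) = ntr (Θ * B) := by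
  rw [ntr, Matrix.trace_mul_comm, ← Matrix.mul_assoc, sqrt_mul_sqrt_of_posSemidef hΘ, ntr]

theorem norm_sqrt_mul_mul_sqrt_le {Θ : Matrix (Fin m) (Fin m) ℂ} (hΘ : Θ.PosSemidef)
    (B : Matrix (Fin m) (Fin m) ℂ) : ‖CFC.sqrt Θ * B * CFC.sqrt Θ‖ ≤ ‖Θ‖ * ‖B‖ := by
  have h : (CFC.sqrt Θ)ᴴ = CFC.sqrt Θ := (CFC.sqrt_nonneg Θ).isSelfAdjoint
  have h2 := Matrix.l2_opNorm_conjTranspose_mul_self (CFC.sqrt Θ)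
  rw [h, sqrt_mul_sqrt_of_posSemidef hΘ] at h2
  calc ‖CFC.sqrt Θ * B * CFC.sqrt Θ‖ ≤ ‖CFC.sqrt Θ‖ * ‖B‖ * ‖CFC.sqrt Θ‖ :=
        (norm_mul_le _ _).trans (mul_le_mul_of_nonneg_right (norm_mul_le _ _) (norm_nonneg _))
    _ = ‖Θ‖ * ‖B‖ := by
        rw [h2]
        ring

theorem correlated_smul_add_smul (Θ : Matrix (Fin m) (Fin m) ℂ) (a b : ℂ) (x y : Fin m → ℂ) :
    a • correlated Θ x + b • correlated Θ y = correlated Θ (a • x + b • y) := by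
  simp only [correlated, Matrix.mulVec_add, Matrix.mulVec_smul]

/-- The coefficient matrix with rows `(c₀, c₂)` and `(c₂, c₁)` is the outer square of `(√c₀, √c₁)`.
-/
theorem perturb_eq_add_vecMulVec (Abar : Matrix (Fin m) (Fin m) ℂ) {c₀ c₁ c₂ : ℝ} (hc₀ : 0 ≤ c₀)
    (hc₁ : 0 ≤ c₁) (hcc : √c₀ * √c₁ = c₂) (x y : Fin m → ℂ) :
    perturb Abar c₀ c₁ c₂ x y
      = Abar + Matrix.vecMulVec ((√c₀ : ℂ) • x + (√c₁ : ℂ) • y)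
        (star ((√c₀ : ℂ) • x + (√c₁ : ℂ) • y)) := by
  have h0 : (c₀ : ℂ) = √c₀ * √c₀ := by exact_mod_cast (Real.mul_self_sqrt hc₀).symm
  have h1 : (c₁ : ℂ) = √c₁ * √c₁ := by exact_mod_cast (Real.mul_self_sqrt hc₁).symm
  have h2 : (c₂ : ℂ) = √c₀ * √c₁ := by exact_mod_cast hcc.symm
  ext i j
  simp only [perturb, Matrix.add_apply, Matrix.smul_apply, Matrix.vecMulVec_apply, Pi.star_apply,
    Pi.add_apply, Pi.smul_apply, smul_eq_mul, star_add, star_mul', h0, h1, h2, RCLike.star_def,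
    Complex.conj_ofReal]
  ring

/-- Sherman–Morrison. For square matrices a right inverse gives both invertibility and the formula
for the inverse. -/
theorem add_vecMulVec_mul_eq_one {A : Matrix (Fin m) (Fin m) ℂ} (hA : IsUnit A) {s : Fin m → ℂ}
    (hs : 1 + sesq s A⁻¹ s ≠ 0) :
    (A + Matrix.vecMulVec s (star s)) * (A⁻¹ - (1 + sesq s A⁻¹ s)⁻¹ •
      Matrix.vecMulVec (A⁻¹ *ᵥ s) (star s ᵥ* A⁻¹)) = 1 := by
  have hA1 : A * A⁻¹ = 1 := Matrix.mul_nonsing_inv A ((Matrix.isUnit_iff_isUnit_det A).1 hA)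
  have e1 : A * Matrix.vecMulVec (A⁻¹ *ᵥ s) (star s ᵥ* A⁻¹)
      = Matrix.vecMulVec s (star s ᵥ* A⁻¹) := by
    rw [Matrix.mul_vecMulVec, Matrix.mulVec_mulVec, hA1, Matrix.one_mulVec]
  have e2 : Matrix.vecMulVec s (star s) * A⁻¹ = Matrix.vecMulVec s (star s ᵥ* A⁻¹) :=
    Matrix.vecMulVec_mul _ _ _
  have e3 : Matrix.vecMulVec s (star s) * Matrix.vecMulVec (A⁻¹ *ᵥ s) (star s ᵥ* A⁻¹)
      = sesq s A⁻¹ s • Matrix.vecMulVec s (star s ᵥ* A⁻¹) := by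
    ext i j
    simp only [Matrix.vecMulVec_mul_vecMulVec, sesq, Matrix.vecMulVec_apply, Matrix.smul_apply,
      Pi.smul_apply, smul_eq_mul]
    ring
  rw [Matrix.add_mul, Matrix.mul_sub, Matrix.mul_sub, Matrix.mul_smul, Matrix.mul_smul, hA1, e1,
    e2, e3]
  set P := Matrix.vecMulVec s (star s ᵥ* A⁻¹)
  have h : (1 + sesq s A⁻¹ s)⁻¹ • P + (1 + sesq s A⁻¹ s)⁻¹ • sesq s A⁻¹ s • P = P := by
    rw [smul_smul, ← add_smul]
    have : (1 + sesq s A⁻¹ s)⁻¹ + (1 + sesq s A⁻¹ s)⁻¹ * sesq s A⁻¹ s = 1 := by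
      field_simp
    rw [this, one_smul]
  calc _ = 1 + P - ((1 + sesq s A⁻¹ s)⁻¹ • P + (1 + sesq s A⁻¹ s)⁻¹ • sesq s A⁻¹ s • P) := by abel
    _ = 1 := by
      rw [h]
      abel

theorem isUnit_add_vecMulVec {A : Matrix (Fin m) (Fin m) ℂ} (hA : IsUnit A) {s : Fin m → ℂ}
    (hs : 1 + sesq s A⁻¹ s ≠ 0) : IsUnit (A + Matrix.vecMulVec s (star s)) :=
  (Matrix.isUnit_iff_isUnit_det _).2
    (Matrix.isUnit_det_of_right_inverse (add_vecMulVec_mul_eq_one hA hs))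

theorem sesq_add_vecMulVec_inv {A : Matrix (Fin m) (Fin m) ℂ} (hA : IsUnit A) {s : Fin m → ℂ}
    (hs : 1 + sesq s A⁻¹ s ≠ 0) (L R : Matrix (Fin m) (Fin m) ℂ) (x y : Fin m → ℂ) :
    sesq x (L * (A + Matrix.vecMulVec s (star s))⁻¹ * R) y
      = sesq x (L * A⁻¹ * R) y
        - sesq x (L * A⁻¹) s * sesq s (A⁻¹ * R) y / (1 + sesq s A⁻¹ s) := by
  rw [Matrix.inv_eq_right_inv (add_vecMulVec_mul_eq_one hA hs)]
  have e : sesq x (L * Matrix.vecMulVec (A⁻¹ *ᵥ s) (star s ᵥ* A⁻¹) * R) y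
      = sesq x (L * A⁻¹) s * sesq s (A⁻¹ * R) y := by
    simp only [sesq, Matrix.mul_vecMulVec, Matrix.vecMulVec_mul, Matrix.mulVec_mulVec,
      Matrix.vecMul_vecMul, Matrix.vecMulVec_mulVec, Matrix.dotProduct_mulVec,
      dotProduct_smul, MulOpposite.smul_eq_mul_unop, MulOpposite.unop_op]
  have e2 : ∀ B C : Matrix (Fin m) (Fin m) ℂ, sesq x (B - C) y = sesq x B y - sesq x C y :=
    fun B C => by simp only [sesq, Matrix.sub_mulVec, dotProduct_sub]
  have e3 : ∀ (c : ℂ) (C : Matrix (Fin m) (Fin m) ℂ), sesq x (c • C) y = c * sesq x C y :=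
    fun c C => by simp only [sesq, Matrix.smul_mulVec, dotProduct_smul, smul_eq_mul]
  rw [Matrix.mul_sub, Matrix.sub_mul, e2, Matrix.mul_smul, Matrix.smul_mul, e3, e]
  ring

end LinearAlgebra

/-- Since `s - u → 0`, the denominator `1 + s` is eventually at least `δ / 2` in norm, so it
inherits the lower bound assumed for `1 + u`. -/
theorem tendsto_sub_mul_div {e E p P r Q s u : ℕ → ℂ}
    (he : Tendsto (fun N => e N - E N) atTop (𝓝 0)) (hp : Tendsto (fun N => p N - P N) atTop (𝓝 0))
    (hr : Tendsto (fun N => r N - Q N) atTop (𝓝 0)) (hs : Tendsto (fun N => s N - u N) atTop (𝓝 0))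
    {C : ℝ} (hP : ∀ N, ‖P N‖ ≤ C) (hQ : ∀ N, ‖Q N‖ ≤ C) {δ : ℝ} (hδ : 0 < δ)
    (hu : ∀ᶠ N in atTop, δ ≤ ‖1 + u N‖) :
    (∀ᶠ N in atTop, 1 + s N ≠ 0) ∧
      Tendsto (fun N => (e N - p N * r N / (1 + s N)) - (E N - P N * Q N / (1 + u N)))
        atTop (𝓝 0) := by
  have hlow : ∀ᶠ N in atTop, δ / 2 ≤ ‖1 + s N‖ := by
    have h1 := (tendsto_zero_iff_norm_tendsto_zero.1 hs).eventually_lt_const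
      (by positivity : (0 : ℝ) < δ / 2)
    filter_upwards [h1, hu] with N h2 h3
    have h4 := norm_sub_le (1 + s N) (s N - u N)
    have h5 : 1 + s N - (s N - u N) = 1 + u N := by ring
    rw [h5] at h4
    linarith
  have hne : ∀ᶠ N in atTop, 1 + s N ≠ 0 := hlow.mono fun N h => norm_pos_iff.1 (by linarith)
  refine ⟨hne, ?_⟩
  have hPb : P =O[atTop] fun _ => (1 : ℂ) := Asymptotics.IsBigO.of_bound C (by simp [hP])
  have hQb : Q =O[atTop] fun _ => (1 : ℂ) := Asymptotics.IsBigO.of_bound C (by simp [hQ])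
  have hsb : (fun N => (1 + s N)⁻¹) =O[atTop] fun _ => (1 : ℂ) := by
    refine Asymptotics.IsBigO.of_bound (δ / 2)⁻¹ (hlow.mono fun N h => ?_)
    rw [norm_inv, norm_one, mul_one]
    exact inv_anti₀ (by positivity) h
  have hub : (fun N => (1 + u N)⁻¹) =O[atTop] fun _ => (1 : ℂ) := by
    refine Asymptotics.IsBigO.of_bound δ⁻¹ (hu.mono fun N h => ?_)
    rw [norm_inv, norm_one, mul_one]
    exact inv_anti₀ hδ h
  have hp' := (Asymptotics.isLittleO_one_iff ℂ).2 hp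
  have hr' := (Asymptotics.isLittleO_one_iff ℂ).2 hr
  have hs' := (Asymptotics.isLittleO_one_iff ℂ).2 hs
  have he' := (Asymptotics.isLittleO_one_iff ℂ).2 he
  have hrb : r =O[atTop] fun _ => (1 : ℂ) := (hr'.isBigO.add hQb).congr_left fun N => by ring
  -- Telescoping: `p r / (1 + s) - P Q / (1 + u)` equals `(p - P) r / (1 + s) + (r - Q) P / (1 + s)
  -- - (s - u) P Q / ((1 + s) (1 + u))`.
  have t1 := (hp'.mul_isBigO hrb).mul_isBigO hsb
  have t2 := (hr'.mul_isBigO hPb).mul_isBigO hsb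
  have t3 := (((hs'.mul_isBigO hPb).mul_isBigO hQb).mul_isBigO hsb).mul_isBigO hub
  simp only [mul_one] at t1 t2 t3
  refine ((Asymptotics.isLittleO_one_iff ℂ).1 (((he'.sub t1).sub t2).add t3)).congr' ?_
  filter_upwards [hne, hu] with N h1 h2
  have h3 : 1 + u N ≠ 0 := norm_pos_iff.1 (by linarith)
  field_simp
  ring

/-! ### Deterministic equivalents for a rank-one perturbation. -/

section Main

variable {Ω : Type*} [MeasurableSpace Ω] {μ : Measure Ω} {M : ℕ → ℕ}

theorem AEBounded.mul {B C : ∀ N : ℕ, Ω → Matrix (Fin (M N)) (Fin (M N)) ℂ}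
    (hB : AEBounded μ B) (hC : AEBounded μ C) : AEBounded μ fun N ω => B N ω * C N ω := by
  filter_upwards [hB, hC] with ω ⟨b, hb⟩ ⟨c, hc⟩
  exact ⟨b * c, fun N => (norm_mul_le _ _).trans
    (mul_le_mul (hb N) (hc N) (norm_nonneg _) ((norm_nonneg _).trans (hb N)))⟩

/-- The two factors `Θ^{1/2}` move into the middle matrix, and cyclicity of the trace recombines
them into `Θ`. Unit coefficient vectors have entries of modulus at most one. -/
theorem asympEq_sesq_correlated [IsProbabilityMeasure μ] (hM : StrictMono M)
    {Θ : ∀ N : ℕ, Matrix (Fin (M N)) (Fin (M N)) ℂ} (hΘ : ∀ N, (Θ N).PosSemidef)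
    (hΘb : ∃ C : ℝ, ∀ N, ‖Θ N‖ ≤ C)
    {V : Fin 3 → ∀ N, Ω → Fin (M N) → ℂ} (hV : ∀ a, IsIIDSequence μ M (V a))
    (hVi : ∀ N, iIndepFun (fun a => V a N) μ) {B : ∀ N, Ω → Matrix (Fin (M N)) (Fin (M N)) ℂ}
    (hBm : ∀ N, Measurable (B N)) (hBV : ∀ N, IndepFun (B N) (fun ω a => V a N ω) μ)
    (hB : AEBounded μ B) {α α' : Fin 3 → ℝ} (hα : α ⬝ᵥ α = 1) (hα' : α' ⬝ᵥ α' = 1) :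
    AsympEq μ (fun N ω => sesq (correlated (Θ N) (∑ a, (α a : ℂ) • V a N ω)) (B N ω)
        (correlated (Θ N) (∑ b, (α' b : ℂ) • V b N ω)))
      (fun N ω => ((α ⬝ᵥ α' : ℝ) : ℂ) * ntr (Θ N * B N ω)) := by
  have hunit : ∀ β : Fin 3 → ℝ, β ⬝ᵥ β = 1 → ∀ a, ‖(β a : ℂ)‖ ≤ 1 := fun β hβ a => by
    rw [Complex.norm_real, Real.norm_eq_abs, ← sq_le_one_iff_abs_le_one, ← hβ, sq]
    exact Finset.single_le_sum (f := fun a => β a * β a) (fun b _ => mul_self_nonneg _)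
      (Finset.mem_univ a)
  have hg : ∀ N, Measurable fun A : Matrix (Fin (M N)) (Fin (M N)) ℂ =>
      CFC.sqrt (Θ N) * A * CFC.sqrt (Θ N) := fun N =>
    ((continuous_const.matrix_mul continuous_id).matrix_mul continuous_const).measurable
  obtain ⟨C, hC⟩ := hΘb
  have h := asympEq_sesq hM hV hVi (B := fun N ω => CFC.sqrt (Θ N) * B N ω * CFC.sqrt (Θ N))
    (fun N => (hg N).comp (hBm N)) (fun N => (hBV N).comp (hg N) measurable_id)
    (by
      filter_upwards [hB] with ω ⟨b, hb⟩
      exact ⟨C * b, fun N => (norm_sqrt_mul_mul_sqrt_le (hΘ N) _).trans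
        (mul_le_mul (hC N) (hb N) (norm_nonneg _) ((norm_nonneg _).trans (hC N)))⟩)
    (hunit α hα) (hunit α' hα')
  have e : ((α ⬝ᵥ α' : ℝ) : ℂ) = ∑ a, star (α a : ℂ) * α' a := by
    simp [dotProduct]
  filter_upwards [h] with ω hω
  simp only [sesq_correlated, e]
  simpa only [ntr_sqrt_mul_mul_sqrt (hΘ _)] using hω

/-- Deterministic equivalent of a sesquilinear form in the inverse of a rank one perturbation. -/
theorem asympEq_sesq_rankOne [IsProbabilityMeasure μ] (hM : StrictMono M)
    {Θ : ∀ N : ℕ, Matrix (Fin (M N)) (Fin (M N)) ℂ} (hΘ : ∀ N, (Θ N).PosSemidef)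
    (hΘb : ∃ C : ℝ, ∀ N, ‖Θ N‖ ≤ C)
    {L R Abar : ∀ N : ℕ, Ω → Matrix (Fin (M N)) (Fin (M N)) ℂ}
    (hLm : ∀ N, Measurable (L N)) (hRm : ∀ N, Measurable (R N)) (hAm : ∀ N, Measurable (Abar N))
    (hLb : AEBounded μ L) (hRb : AEBounded μ R) (hAinv : ∀ N, ∀ᵐ ω ∂μ, IsUnit (Abar N ω))
    (hAinvb : AEBounded μ (fun N ω => (Abar N ω)⁻¹))
    (hu : ∀ᵐ ω ∂μ, ∃ δ : ℝ, 0 < δ ∧ ∀ᶠ N in atTop, δ ≤ ‖1 + ntr (Θ N * (Abar N ω)⁻¹)‖)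
    {V : Fin 3 → ∀ N, Ω → Fin (M N) → ℂ} (hV : ∀ a, IsIIDSequence μ M (V a))
    (hVi : ∀ N, iIndepFun (fun a => V a N) μ)
    (hTV : ∀ N, IndepFun (fun ω => (L N ω, R N ω, Abar N ω)) (fun ω a => V a N ω) μ)
    {α α' σ : Fin 3 → ℝ} (hα : α ⬝ᵥ α = 1) (hα' : α' ⬝ᵥ α' = 1) (hσ : σ ⬝ᵥ σ = 1)
    {A : ∀ N : ℕ, Ω → Matrix (Fin (M N)) (Fin (M N)) ℂ}
    (hA : ∀ N ω, A N ω = Abar N ω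
      + Matrix.vecMulVec (correlated (Θ N) (∑ a, (σ a : ℂ) • V a N ω))
        (star (correlated (Θ N) (∑ a, (σ a : ℂ) • V a N ω)))) :
    (∀ᵐ ω ∂μ, ∀ᶠ N in atTop, IsUnit (A N ω)) ∧
    AsympEq μ
      (fun N ω => sesq (correlated (Θ N) (∑ a, (α a : ℂ) • V a N ω)) (L N ω * (A N ω)⁻¹ * R N ω)
        (correlated (Θ N) (∑ a, (α' a : ℂ) • V a N ω)))
      (fun N ω => ((α ⬝ᵥ α' : ℝ) : ℂ) * ntr (Θ N * L N ω * (Abar N ω)⁻¹ * R N ω)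
        - (((α ⬝ᵥ σ : ℝ) : ℂ) * ntr (Θ N * L N ω * (Abar N ω)⁻¹))
          * (((σ ⬝ᵥ α' : ℝ) : ℂ) * ntr (Θ N * (Abar N ω)⁻¹ * R N ω))
          / (1 + ntr (Θ N * (Abar N ω)⁻¹))) := by
  have hp1 : ∀ N, Measurable fun T : Matrix (Fin (M N)) (Fin (M N)) ℂ
      × Matrix (Fin (M N)) (Fin (M N)) ℂ × Matrix (Fin (M N)) (Fin (M N)) ℂ => T.1 :=
    fun N => measurable_fst
  have hp2 : ∀ N, Measurable fun T : Matrix (Fin (M N)) (Fin (M N)) ℂ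
      × Matrix (Fin (M N)) (Fin (M N)) ℂ × Matrix (Fin (M N)) (Fin (M N)) ℂ => T.2.1 :=
    fun N => measurable_fst.comp measurable_snd
  have hp3 : ∀ N, Measurable fun T : Matrix (Fin (M N)) (Fin (M N)) ℂ
      × Matrix (Fin (M N)) (Fin (M N)) ℂ × Matrix (Fin (M N)) (Fin (M N)) ℂ => T.2.2 :=
    fun N => measurable_snd.comp measurable_snd
  have hf1 : ∀ N, Measurable fun T : Matrix (Fin (M N)) (Fin (M N)) ℂ
      × Matrix (Fin (M N)) (Fin (M N)) ℂ × Matrix (Fin (M N)) (Fin (M N)) ℂ => T.2.2⁻¹ :=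
    fun N => measurable_matrix_inv (hp3 N)
  have hf2 : ∀ N, Measurable fun T : Matrix (Fin (M N)) (Fin (M N)) ℂ
      × Matrix (Fin (M N)) (Fin (M N)) ℂ × Matrix (Fin (M N)) (Fin (M N)) ℂ => T.1 * T.2.2⁻¹ :=
    fun N => measurable_matrix_mul (hp1 N) (hf1 N)
  have hf3 : ∀ N, Measurable fun T : Matrix (Fin (M N)) (Fin (M N)) ℂ
      × Matrix (Fin (M N)) (Fin (M N)) ℂ × Matrix (Fin (M N)) (Fin (M N)) ℂ => T.2.2⁻¹ * T.2.1 :=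
    fun N => measurable_matrix_mul (hf1 N) (hp2 N)
  have hf4 : ∀ N, Measurable fun T : Matrix (Fin (M N)) (Fin (M N)) ℂ
      × Matrix (Fin (M N)) (Fin (M N)) ℂ × Matrix (Fin (M N)) (Fin (M N)) ℂ => T.1 * T.2.2⁻¹ * T.2.1 :=
    fun N => measurable_matrix_mul (hf2 N) (hp2 N)
  have m4 : ∀ N, Measurable fun ω => (Abar N ω)⁻¹ := fun N =>
    measurable_matrix_inv (hAm N)
  have m2 : ∀ N, Measurable fun ω => L N ω * (Abar N ω)⁻¹ := fun N =>
    measurable_matrix_mul (hLm N) (m4 N)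
  have m3 : ∀ N, Measurable fun ω => (Abar N ω)⁻¹ * R N ω := fun N =>
    measurable_matrix_mul (m4 N) (hRm N)
  have m1 : ∀ N, Measurable fun ω => L N ω * (Abar N ω)⁻¹ * R N ω := fun N =>
    measurable_matrix_mul (m2 N) (hRm N)
  have i1 : ∀ N, IndepFun (fun ω => L N ω * (Abar N ω)⁻¹ * R N ω) (fun ω a => V a N ω) μ := fun N => by
    have := (hTV N).comp (hf4 N) measurable_id
    exact this
  have b1 : AEBounded μ fun N ω => L N ω * (Abar N ω)⁻¹ * R N ω := (hLb.mul hAinvb).mul hRb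
  have h1 := asympEq_sesq_correlated hM hΘ hΘb hV hVi m1 i1 b1 hα hα'
  have i2 : ∀ N, IndepFun (fun ω => L N ω * (Abar N ω)⁻¹) (fun ω a => V a N ω) μ := fun N => by
    have := (hTV N).comp (hf2 N) measurable_id
    exact this
  have b2 : AEBounded μ fun N ω => L N ω * (Abar N ω)⁻¹ := hLb.mul hAinvb
  have h2 := asympEq_sesq_correlated hM hΘ hΘb hV hVi m2 i2 b2 hα hσ
  have i3 : ∀ N, IndepFun (fun ω => (Abar N ω)⁻¹ * R N ω) (fun ω a => V a N ω) μ := fun N => by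
    have := (hTV N).comp (hf3 N) measurable_id
    exact this
  have b3 : AEBounded μ fun N ω => (Abar N ω)⁻¹ * R N ω := hAinvb.mul hRb
  have h3 := asympEq_sesq_correlated hM hΘ hΘb hV hVi m3 i3 b3 hσ hα'
  have i4 : ∀ N, IndepFun (fun ω => (Abar N ω)⁻¹) (fun ω a => V a N ω) μ := fun N => by
    have := (hTV N).comp (hf1 N) measurable_id
    exact this
  have b4 : AEBounded μ fun N ω => (Abar N ω)⁻¹ := hAinvb
  have h4 := asympEq_sesq_correlated hM hΘ hΘb hV hVi m4 i4 b4 hσ hσ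
  obtain ⟨c, hc⟩ := hΘb
  have key : ∀ᵐ ω ∂μ, (∀ᶠ N in atTop, IsUnit (A N ω)) ∧ Tendsto (fun N =>
      sesq (correlated (Θ N) (∑ a, (α a : ℂ) • V a N ω)) (L N ω * (A N ω)⁻¹ * R N ω)
        (correlated (Θ N) (∑ a, (α' a : ℂ) • V a N ω))
      - (((α ⬝ᵥ α' : ℝ) : ℂ) * ntr (Θ N * L N ω * (Abar N ω)⁻¹ * R N ω)
        - (((α ⬝ᵥ σ : ℝ) : ℂ) * ntr (Θ N * L N ω * (Abar N ω)⁻¹))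
          * (((σ ⬝ᵥ α' : ℝ) : ℂ) * ntr (Θ N * (Abar N ω)⁻¹ * R N ω))
          / (1 + ntr (Θ N * (Abar N ω)⁻¹)))) atTop (𝓝 0) := by
    filter_upwards [h1, h2, h3, h4, hLb.mul hAinvb, hAinvb.mul hRb, hu, ae_all_iff.2 hAinv] with ω
      g1 g2 g3 g4 ⟨b1, hb1⟩ ⟨b2, hb2⟩ ⟨δ, hδ, hu⟩ hinv
    simp only [hσ, Complex.ofReal_one, one_mul, ← Matrix.mul_assoc]
      at g1 g2 g3 g4
    have bound : ∀ (r b : ℝ) (N : ℕ) (B : Matrix (Fin (M N)) (Fin (M N)) ℂ), ‖B‖ ≤ b →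
        ‖(r : ℂ) * ntr (Θ N * B)‖ ≤ |r| * (c * b) := fun r b N B hB => by
      rw [norm_mul, Complex.norm_real, Real.norm_eq_abs]
      refine mul_le_mul_of_nonneg_left ?_ (abs_nonneg _)
      exact (norm_ntr_le _).trans ((norm_mul_le _ _).trans
        (mul_le_mul (hc N) hB (norm_nonneg _) ((norm_nonneg _).trans (hc N))))
    -- The four forms are those of Sherman–Morrison. Since `σ` is a unit vector, the form in the
    -- denominator tends to the normalized trace itself, for which the lower bound is assumed.
    obtain ⟨k1, k2⟩ := tendsto_sub_mul_div g1 g2 g3 g4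
      (C := max (|α ⬝ᵥ σ| * (c * b1)) (|σ ⬝ᵥ α'| * (c * b2)))
      (fun N => by
        rw [Matrix.mul_assoc]
        exact (bound _ _ N _ (hb1 N)).trans (le_max_left _ _))
      (fun N => by
        rw [Matrix.mul_assoc]
        exact (bound _ _ N _ (hb2 N)).trans (le_max_right _ _)) hδ hu
    refine ⟨k1.mono fun N hN => ?_, k2.congr' (k1.mono fun N hN => ?_)⟩
    · rw [hA]
      exact isUnit_add_vecMulVec (hinv N) hN
    · dsimp only
      rw [hA, sesq_add_vecMulVec_inv (hinv N) hN]
  exact ⟨key.mono fun ω h => h.1, key.mono fun ω h => h.2⟩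

end Main

/-- The vectors must be independent of each other and, as one block, of the matrices; both follow by
grouping the four σ-algebras. -/
theorem iIndepFun_and_indepFun_of_iIndep {Ω : Type*} [MeasurableSpace Ω] {μ : Measure Ω}
    {E F : Type*} [MeasurableSpace E] [MeasurableSpace F] {X Y Z : Ω → E} {T : Ω → F}
    (hX : Measurable X) (hY : Measurable Y) (hZ : Measurable Z) (hT : Measurable T)
    (h : iIndep ![MeasurableSpace.comap X inferInstance, MeasurableSpace.comap Y inferInstance,
      MeasurableSpace.comap Z inferInstance, MeasurableSpace.comap T inferInstance] μ) :
    iIndepFun ![X, Y, Z] μ ∧ IndepFun T (fun ω a => ![X, Y, Z] a ω) μ := by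
  set m : Fin 4 → MeasurableSpace Ω := ![MeasurableSpace.comap X inferInstance,
    MeasurableSpace.comap Y inferInstance, MeasurableSpace.comap Z inferInstance,
    MeasurableSpace.comap T inferInstance] with hm
  have hcomap : ∀ a : Fin 3, MeasurableSpace.comap (![X, Y, Z] a) inferInstance = m a.castSucc := by
    intro a
    fin_cases a <;> rfl
  refine ⟨?_, ?_⟩
  · have h2 := h.precomp (Fin.castSucc_injective 3)
    have e : m ∘ Fin.castSucc = fun a => MeasurableSpace.comap (![X, Y, Z] a) inferInstance :=
      funext fun a => (hcomap a).symm
    rw [e] at h2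
    exact h2
  · have hle : ∀ i, m i ≤ ‹MeasurableSpace Ω› := by
      intro i
      fin_cases i
      · exact hX.comap_le
      · exact hY.comap_le
      · exact hZ.comap_le
      · exact hT.comap_le
    have h2 := indep_iSup_of_disjoint hle h
      (S := {Fin.last 3}) (T := Set.range Fin.castSucc) (by
        rw [Set.disjoint_singleton_left]
        rintro ⟨a, ha⟩
        exact (Fin.castSucc_lt_last a).ne ha)
    refine (IndepFun_iff_Indep _ _ _).2 (indep_of_indep_of_le_left
      (indep_of_indep_of_le_right h2 ?_) ?_)
    · refine Measurable.comap_le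
        (@measurable_pi_iff _ _ _ (⨆ i ∈ Set.range Fin.castSucc, m i) _ _ |>.2 fun a => ?_)
      refine measurable_iff_comap_le.2 ((hcomap a).le.trans ?_)
      exact le_iSup₂_of_le (f := fun i (_ : i ∈ Set.range Fin.castSucc) => m i) a.castSucc ⟨a, rfl⟩
        le_rfl
    · exact le_iSup₂_of_le (f := fun i (_ : i ∈ ({Fin.last 3} : Set (Fin 4))) => m i) (Fin.last 3)
        rfl le_rfl

end RandomMatrix

/-! ### Reduction of the three limits to inner products in `ℝ³`. -/

open RandomMatrix in
theorem mainTheorem3 {Ω : Type*} [MeasurableSpace Ω] (μ : Measure Ω) [IsProbabilityMeasure μ]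
    -- the dimensions, and the deterministic correlation matrices
    (M : ℕ → ℕ) (hM : StrictMono M)
    (Θ : ∀ N : ℕ, Matrix (Fin (M N)) (Fin (M N)) ℂ)
    (hΘ : ∀ N, (Θ N).PosSemidef) (hΘb : ∃ C : ℝ, ∀ N, ‖Θ N‖ ≤ C)
    -- the (possibly random) matrices
    (L R Abar : ∀ N : ℕ, Ω → Matrix (Fin (M N)) (Fin (M N)) ℂ)
    (hLm : ∀ N, Measurable (L N)) (hRm : ∀ N, Measurable (R N))
    (hAm : ∀ N, Measurable (Abar N))
    (hLb : RandomMatrix.AEBounded μ L) (hRb : RandomMatrix.AEBounded μ R)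
    (hAb : RandomMatrix.AEBounded μ Abar)
    (hAinv : ∀ N, ∀ᵐ ω ∂μ, IsUnit (Abar N ω))
    (hAinvb : RandomMatrix.AEBounded μ (fun N ω => (Abar N ω)⁻¹))
    (hu : ∀ᵐ ω ∂μ, ∃ δ : ℝ, 0 < δ ∧
      ∀ᶠ N in atTop, δ ≤ ‖1 + RandomMatrix.ntr (Θ N * (Abar N ω)⁻¹)‖)
    -- the random vectors
    (z z' q w : ∀ N : ℕ, Ω → Fin (M N) → ℂ)
    (hz' : RandomMatrix.IsIIDSequence μ M z') (hq : RandomMatrix.IsIIDSequence μ M q)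
    (hw : RandomMatrix.IsIIDSequence μ M w)
    (hindep : ∀ N, iIndep
      ![MeasurableSpace.comap (z' N) inferInstance, MeasurableSpace.comap (q N) inferInstance,
        MeasurableSpace.comap (w N) inferInstance,
        MeasurableSpace.comap (fun ω => (L N ω, R N ω, Abar N ω)) inferInstance] μ)
    (ρ : ℝ) (hρ : ρ ∈ Set.Icc (-1 : ℝ) 1)
    (hz : ∀ N ω, z N ω = (ρ : ℂ) • z' N ω + ((Real.sqrt (1 - ρ ^ 2) : ℝ) : ℂ) • w N ω)
    -- the coefficients
    (c₀ c₁ c₂ : ℝ) (hc₀ : 0 ≤ c₀) (hc₁ : 0 ≤ c₁) (hc₂ : 0 ≤ c₂)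
    (hc : c₀ + c₁ = 1) (hcc : c₀ * c₁ - c₂ ^ 2 = 0) :
    let x := fun N ω => RandomMatrix.correlated (Θ N) (z N ω)
    let x' := fun N ω => RandomMatrix.correlated (Θ N) (z' N ω)
    let y := fun N ω => RandomMatrix.correlated (Θ N) (q N ω)
    let A := fun N ω => RandomMatrix.perturb (Abar N ω) c₀ c₁ c₂ (x N ω) (y N ω)
    let A' := fun N ω => RandomMatrix.perturb (Abar N ω) c₀ c₁ c₂ (x' N ω) (y N ω)
    let u := fun N ω => RandomMatrix.ntr (Θ N * (Abar N ω)⁻¹)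
    let uL := fun N ω => RandomMatrix.ntr (Θ N * L N ω * (Abar N ω)⁻¹)
    let uR := fun N ω => RandomMatrix.ntr (Θ N * (Abar N ω)⁻¹ * R N ω)
    let uLR := fun N ω => RandomMatrix.ntr (Θ N * L N ω * (Abar N ω)⁻¹ * R N ω)
    (∀ᵐ ω ∂μ, ∀ᶠ N in atTop, IsUnit (A N ω) ∧ IsUnit (A' N ω)) ∧
    RandomMatrix.AsympEq μ
      (fun N ω => RandomMatrix.sesq (x N ω) (L N ω * (A N ω)⁻¹ * R N ω) (x N ω))
      (fun N ω => uLR N ω - c₀ * uL N ω * uR N ω / (1 + u N ω)) ∧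
    RandomMatrix.AsympEq μ
      (fun N ω => RandomMatrix.sesq (x N ω) (L N ω * (A N ω)⁻¹ * R N ω) (y N ω))
      (fun N ω => -(c₂ * uL N ω * uR N ω / (1 + u N ω))) ∧
    RandomMatrix.AsympEq μ
      (fun N ω => RandomMatrix.sesq (x N ω) (L N ω * (A' N ω)⁻¹ * R N ω) (y N ω))
      (fun N ω => -(ρ * (c₂ * uL N ω * uR N ω / (1 + u N ω)))) := by

  intro x x' y A A' u uL uR uLR
  have hind := fun N => iIndepFun_and_indepFun_of_iIndep (hz'.measurable N) (hq.measurable N)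
    (hw.measurable N) ((hLm N).prodMk ((hRm N).prodMk (hAm N))) (hindep N)
  set V : Fin 3 → ∀ N, Ω → Fin (M N) → ℂ := ![z', q, w] with hVdef
  have hVN : ∀ N, (fun a => V a N) = ![z' N, q N, w N] := fun N => by
    funext a
    fin_cases a <;> rfl
  have hV : ∀ a, IsIIDSequence μ M (V a) := by
    intro a
    fin_cases a
    · exact hz'
    · exact hq
    · exact hw
  have hVi : ∀ N, iIndepFun (fun a => V a N) μ := fun N => by
    rw [hVN]
    exact (hind N).1
  have hTV : ∀ N, IndepFun (fun ω => (L N ω, R N ω, Abar N ω)) (fun ω a => V a N ω) μ := fun N => by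
    have e : (fun ω a => V a N ω) = fun ω a => ![z' N, q N, w N] a ω := by
      funext ω a
      rw [← hVN]
    rw [e]
    exact (hind N).2
  have hρ2 : 0 ≤ 1 - ρ ^ 2 := by nlinarith [hρ.1, hρ.2]
  set τ := √(1 - ρ ^ 2) with hτ
  have hτ2 : τ * τ = 1 - ρ ^ 2 := Real.mul_self_sqrt hρ2
  have hs0 : √c₀ * √c₀ = c₀ := Real.mul_self_sqrt hc₀
  have hs1 : √c₁ * √c₁ = c₁ := Real.mul_self_sqrt hc₁
  have hs2 : √c₀ * √c₁ = c₂ := by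
    rw [← Real.sqrt_mul hc₀, sub_eq_zero.1 hcc, Real.sqrt_sq hc₂]
  have hs2' : (√c₀ : ℂ) * √c₁ = c₂ := by exact_mod_cast hs2
  have hs0' : (√c₀ : ℂ) * √c₀ = c₀ := by exact_mod_cast hs0
  have hsum : ∀ (a b c : ℝ) N ω, ∑ i, ((![a, b, c] i : ℝ) : ℂ) • V i N ω
      = (a : ℂ) • z' N ω + (b : ℂ) • q N ω + (c : ℂ) • w N ω := fun a b c N ω =>
    Fin.sum_univ_three _
  have hdot : ∀ a b c a' b' c' : ℝ, ![a, b, c] ⬝ᵥ ![a', b', c'] = a * a' + b * b' + c * c' :=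
    fun a b c a' b' c' => Fin.sum_univ_three _
  have hx : ∀ N ω, x N ω
      = correlated (Θ N) (∑ a, ((![ρ, 0, τ] a : ℝ) : ℂ) • V a N ω) := fun N ω => by
    rw [hsum, Complex.ofReal_zero, zero_smul, add_zero, ← hz]
  have hy : ∀ N ω, y N ω
      = correlated (Θ N) (∑ a, ((![0, 1, 0] a : ℝ) : ℂ) • V a N ω) := fun N ω => by
    rw [hsum, Complex.ofReal_zero, Complex.ofReal_one, zero_smul, zero_smul, one_smul, zero_add,
      add_zero]
  -- In the coordinates `(z', q, w)`, these represent `√c₀ z + √c₁ q` and `√c₀ z' + √c₁ q`, while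
  -- `z` is `(ρ, 0, τ)` and `q` is `(0, 1, 0)`. All are unit vectors because `ρ² + τ² = 1` and `c₀ +
  -- c₁ = 1`. The factors `c₀`, `c₂` and `ρ c₂` of the three limits arise as the products `√c₀ √c₀`,
  -- `√c₀ √c₁` and `ρ √c₀ √c₁` of inner products, and the leading term disappears from the last two
  -- limits since `z` and `q` are orthogonal here.
  set σ : Fin 3 → ℝ := ![√c₀ * ρ, √c₁, √c₀ * τ] with hσdef
  set σ' : Fin 3 → ℝ := ![√c₀, √c₁, 0] with hσ'def
  have hA : ∀ N ω, A N ω = Abar N ω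
      + Matrix.vecMulVec (correlated (Θ N) (∑ a, (σ a : ℂ) • V a N ω))
        (star (correlated (Θ N) (∑ a, (σ a : ℂ) • V a N ω))) := fun N ω => by
    have e : ∑ a, (σ a : ℂ) • V a N ω = (√c₀ : ℂ) • z N ω + (√c₁ : ℂ) • q N ω := by
      rw [hσdef, hsum, hz, smul_add, smul_smul, smul_smul, Complex.ofReal_mul, Complex.ofReal_mul,
        add_right_comm]
    rw [e, ← correlated_smul_add_smul]
    exact perturb_eq_add_vecMulVec _ hc₀ hc₁ hs2 _ _
  have hA' : ∀ N ω, A' N ω = Abar N ω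
      + Matrix.vecMulVec (correlated (Θ N) (∑ a, (σ' a : ℂ) • V a N ω))
        (star (correlated (Θ N) (∑ a, (σ' a : ℂ) • V a N ω))) := fun N ω => by
    have e : ∑ a, (σ' a : ℂ) • V a N ω = (√c₀ : ℂ) • z' N ω + (√c₁ : ℂ) • q N ω := by
      rw [hσ'def, hsum, Complex.ofReal_zero, zero_smul, add_zero]
    rw [e, ← correlated_smul_add_smul]
    exact perturb_eq_add_vecMulVec _ hc₀ hc₁ hs2 _ _
  have dxx : ![ρ, 0, τ] ⬝ᵥ ![ρ, 0, τ] = 1 := by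
    rw [hdot]
    linear_combination hτ2
  have dyy : (![0, 1, 0] : Fin 3 → ℝ) ⬝ᵥ ![0, 1, 0] = 1 := by
    rw [hdot]
    ring
  have dxy : ![ρ, 0, τ] ⬝ᵥ ![0, 1, 0] = 0 := by
    rw [hdot]
    ring
  have dss : σ ⬝ᵥ σ = 1 := by
    rw [hσdef, hdot]
    linear_combination hc + (ρ * ρ + τ * τ) * hs0 + hs1 + c₀ * hτ2
  have dss' : σ' ⬝ᵥ σ' = 1 := by
    rw [hσ'def, hdot]
    linear_combination hc + hs0 + hs1
  have dxs : ![ρ, 0, τ] ⬝ᵥ σ = √c₀ := by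
    rw [hσdef, hdot]
    linear_combination √c₀ * hτ2
  have dsx : σ ⬝ᵥ ![ρ, 0, τ] = √c₀ := by rw [dotProduct_comm, dxs]
  have dsy : σ ⬝ᵥ ![0, 1, 0] = √c₁ := by
    rw [hσdef, hdot]
    ring
  have dxs' : ![ρ, 0, τ] ⬝ᵥ σ' = ρ * √c₀ := by
    rw [hσ'def, hdot]
    ring
  have dsy' : σ' ⬝ᵥ ![0, 1, 0] = √c₁ := by
    rw [hσ'def, hdot]
    ring
  obtain ⟨hU, h1⟩ := asympEq_sesq_rankOne hM hΘ hΘb hLm hRm hAm hLb hRb hAinv hAinvb hu hV hVi hTV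
    dxx dxx dss hA
  obtain ⟨-, h2⟩ := asympEq_sesq_rankOne hM hΘ hΘb hLm hRm hAm hLb hRb hAinv hAinvb hu hV hVi hTV
    dxx dyy dss hA
  obtain ⟨hU', h3⟩ := asympEq_sesq_rankOne hM hΘ hΘb hLm hRm hAm hLb hRb hAinv hAinvb hu hV hVi hTV
    dxx dyy dss' hA'
  simp only [← hx, ← hy, dxx, dxs, dsx, dxy, dsy, dxs', dsy'] at h1 h2 h3
  refine ⟨?_, ?_, ?_, ?_⟩
  · filter_upwards [hU, hU'] with ω g g'
    exact g.and g'
  · filter_upwards [h1] with ω g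
    refine g.congr fun N => ?_
    simp only [u, uL, uR, uLR, ← hs0', Complex.ofReal_one]
    ring
  · filter_upwards [h2] with ω g
    refine g.congr fun N => ?_
    simp only [u, uL, uR, ← hs2', Complex.ofReal_zero]
    ring
  · filter_upwards [h3] with ω g
    refine g.congr fun N => ?_
    simp only [u, uL, uR, ← hs2', Complex.ofReal_zero, Complex.ofReal_mul]
    ring
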